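/- Write $B_j(0,r)$ for the open ball of radius $r$ about $0$ in $\mathbb R^j$, let $0\le d\le n$, and write points of $\mathbb R^n=\mathbb R^d\oplus\mathbb R^{n-d}$ as $(x,y)$. For every $n\ge 0$, every integer $k\ge 3$ and all constants $C_0,C_1$ and $c_1>0$ there are positive constants $c,c_2,\dots,c_7,C$, depending only on $C_0,c_1,C_1,k,n$, with $c_2\le 1$, $c_3^2+c_4^2\le c_2^2$ (so that $B_d(0,c_4)\times B_{n-d}(0,c_3)\subseteq B_n(0,c_2)$) and $c_5\le c_4$, such that the following holds. Let $0\le d\le n$, let $0<\rho<c$, and let $F:B_n(0,1)\to\mathbb R$ be $C^k$ with $$|\partial^\alpha F|\le C_0\quad\text{on } B_n(0,1)\ \text{ for all } |\alpha|\le k,$$ $$c_1(|y|^2+\rho^2)\le F(x,y)+\rho^2\le C_1(|y|^2+\rho^2)\quad\text{for all } (x,y)\in B_n(0,1).$$ For $z\in B_n(0,1)$ let $N(z)\subseteq\mathbb R^n$ be the span of the eigenvectors of the Hessian $\partial^2F(z)$ that correspond to its $n-d$ largest eigenvalues (counted with multiplicity; if the choice of these eigenvalues splits an eigenspace, the whole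 eigenspace is included), and let $\Pi_{hi}(z)$ be the orthogonal projection of $\mathbb R^n$ onto $N(z)$. Then: 1. For $z\in B_n(0,c_2)$ the space $N(z)$ has dimension $n-d$, and $z\mapsto\Pi_{hi}(z)$ is $C^{k-2}$ on $B_n(0,c_2)$ with $|\partial^\alpha\Pi_{hi}|\le C$ for $|\alpha|\le k-2$. 2. There is a $C^{k-2}$ map $\Psi:B_d(0,c_4)\to B_{n-d}(0,c_3)$ with $|\Psi(0)|\le C\rho$, with $|\partial^\alpha\Psi|\le C^{|\alpha|}$ on $B_d(0,c_4)$ for $1\le|\alpha|\le k-2$, and with $$\{z\in B_d(0,c_4)\times B_{n-d}(0,c_3) : \Pi_{hi}(z)\,\partial F(z)=0\}=\{(x,\Psi(x)) : x\in B_d(0,c_4)\},$$ where $\partial F$ is the gradient of $F$. 3. With this $\Psi$, every $z\in B_n(0,c_7)$ can be written uniquely as $z=(x,\Psi(x))+v$ with $x\in B_d(0,c_5)$ and $v\in N(x,\Psi(x))\cap B_n(0,c_6)$. The functions $\Phi_d:B_n(0,c_7)\to B_d(0,c_5)$ and $\Phi_{n-d}:B_n(0,c_7)\to B_n(0,c_6)$,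 given by $\Phi_d(z)=x$ and $\Phi_{n-d}(z)=v$, are $C^{k-2}$, and their derivatives of order up to $k-2$ are at most $C$ in absolute value. -/

import Mathlib

noncomputable section

namespace KeyLemma

/-- `ℝ^ι` with the Euclidean norm. -/
abbrev E (ι : Type) : Type := EuclideanSpace ℝ ι

/-- The point `(x, y)` of `ℝ^d ⊕ ℝ^m`. -/
def pt {d m : ℕ} (x : E (Fin d)) (y : E (Fin m)) : E (Fin d ⊕ Fin m) :=
  WithLp.toLp 2 (Sum.elim x y)

/-- The mixed partial derivative `∂_{σ 0} ⋯ ∂_{σ (j-1)} f` at the point `z`. As `σ` ranges over all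
maps `Fin j → ι`, these are all the derivatives `∂^α f` with `|α| = j`. -/
def mixedPartial {ι : Type} [Fintype ι] [DecidableEq ι]
    {G : Type*} [NormedAddCommGroup G] [NormedSpace ℝ G]
    (f : E ι → G) {j : ℕ} (σ : Fin j → ι) (z : E ι) : G :=
  iteratedFDeriv ℝ j f z (fun i => EuclideanSpace.single (σ i) (1 : ℝ))

/-- `|∂^α f| ≤ C` on `s` for all multi-indices `α` with `|α| ≤ k`. -/
def PartialsBoundedBy {ι : Type} [Fintype ι] [DecidableEq ι]
    {G : Type*} [NormedAddCommGroup G] [NormedSpace ℝ G]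
    (k : ℕ) (C : ℝ) (f : E ι → G) (s : Set (E ι)) : Prop :=
  ∀ z ∈ s, ∀ j ≤ k, ∀ σ : Fin j → ι, ‖mixedPartial f σ z‖ ≤ C

/-- The Hessian `∂²F(z)`, the endomorphism of `ℝ^ι` with matrix `(∂_i ∂_j F(z))`. -/
def hessian {ι : Type} [Fintype ι] [DecidableEq ι] (F : E ι → ℝ) (z : E ι) :
    Module.End ℝ (E ι) :=
  Matrix.toEuclideanLin (Matrix.of fun i j : ι => mixedPartial F ![i, j] z)

/-- The span of the eigenvectors of `A` that belong to its `m` largest eigenvalues, counted with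
multiplicity: an eigenvalue `μ` is among these if fewer than `m` eigenvalues are larger than `μ`.
For symmetric `A` on a space of dimension at least `m`, it has dimension at least `m`, with equality
exactly if the choice of the `m` largest eigenvalues does not split an eigenspace. -/
def topEigenspan {V : Type*} [AddCommGroup V] [Module ℝ V] (A : Module.End ℝ V) (m : ℕ) :
    Submodule ℝ V :=
  ⨆ (μ : ℝ) (_ : Module.finrank ℝ ↥(⨆ (ν : ℝ) (_ : μ < ν), A.eigenspace ν) < m), A.eigenspace μ

/-- The subspace `N(z)`, for a function of `(x, y) ∈ ℝ^d ⊕ ℝ^m`: the span of the eigenvectors of the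
Hessian at `z` for the `m` largest eigenvalues. -/
def N {d m : ℕ} (F : E (Fin d ⊕ Fin m) → ℝ) (z : E (Fin d ⊕ Fin m)) :
    Submodule ℝ (E (Fin d ⊕ Fin m)) :=
  topEigenspan (hessian F z) m

/-- The orthogonal projection `Π_hi(z)` of `ℝ^d ⊕ ℝ^m` onto `N(z)`. -/
def projHi {d m : ℕ} (F : E (Fin d ⊕ Fin m) → ℝ) (z : E (Fin d ⊕ Fin m)) :
    E (Fin d ⊕ Fin m) →L[ℝ] E (Fin d ⊕ Fin m) :=
  (N F z).starProjection

end KeyLemma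

end

/-!
Write `H` for the Hessian of `F`, in blocks with respect to `ℝ^d ⊕ ℝ^m`. The two-sided bound on `F`
constrains `F` at a scale `δ ≫ √ρ` about the origin up to errors that are small relative to
`δ ^ 2`. The Taylor formula at that scale shows that `∂F(0) = O(ρ)`, that the `yy` block of `H(0)` is
at least `c₁`, and that the `xx` block is nearly zero; as `H(0)` is nearly nonnegative, the `xy` block
then is nearly zero too (`exists_estimates_at_zero`). On a small ball `H` stays close to `H(0)`.

For such `H`, the Riccati equation `L (H_yx L + H_yy) = H_xx L + H_xy` has a unique small solution
`L(z)`. It says that the graph `{(L y, y)}` is invariant under `H`. The eigenvalues on the graph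
exceed `c₁ / 2` and those on its orthogonal complement do not, so that the graph is `N(z)`
(`topEigenspan_eq_range_graphMap`). The orthogonal projection onto it is `J (J* J)⁻¹ J*` with
`J y = (L y, y)`, and the equation `Π_hi ∂F = 0` becomes `∂_y F + L* ∂_x F = 0`, which determines
`y = Ψ(x)`. Finally `z = (x, Ψ x) + v` with `v ∈ N(x, Ψ x)` means
`z_x - x = L(x, Ψ x) (z_y - Ψ x)`, which determines `x` as a function of `z`.

So `L`, `(J* J)⁻¹`, `Ψ` and the coordinate `x` of `z` are solutions of equations `G(z, u) = 0`, in
which `u ↦ u - G(z, u)` is a contraction, if necessary after composing with the inverse of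
`H_yy(0)`. `BddCk.exists_implicit` is the implicit function theorem for such equations, with bounds
on the derivatives of the solution that depend only on the bounds for `G`, and not on the spaces.
The equations involve `F` through its first and second derivatives, whence the loss of two
derivatives. The constants are independent of `d` because every space enters through operator norms
only.
-/

noncomputable section

open Set Metric
open scoped ContDiff

/-! ### Functions with bounded derivatives -/

namespace KeyLemma

theorem norm_comp_le_mul {A B D : Type*} [NormedAddCommGroup A] [NormedSpace ℝ A]
    [NormedAddCommGroup B] [NormedSpace ℝ B] [NormedAddCommGroup D] [NormedSpace ℝ D]
    {f : B →L[ℝ] D} {g : A →L[ℝ] B} {a b : ℝ} (hf : ‖f‖ ≤ a) (hg : ‖g‖ ≤ b) :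
    ‖f.comp g‖ ≤ a * b :=
  (ContinuousLinearMap.opNorm_comp_le f g).trans
    (mul_le_mul hf hg (norm_nonneg _) ((norm_nonneg _).trans hf))

theorem norm_precomp_le {A B D : Type*} [NormedAddCommGroup A] [NormedSpace ℝ A]
    [NormedAddCommGroup B] [NormedSpace ℝ B] [NormedAddCommGroup D] [NormedSpace ℝ D]
    {g : A →L[ℝ] B} {b : ℝ} (hg : ‖g‖ ≤ b) :
    ‖(ContinuousLinearMap.compL ℝ A B D).flip g‖ ≤ b :=
  ContinuousLinearMap.opNorm_le_bound _ ((norm_nonneg _).trans hg) fun φ => by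
    rw [mul_comm]
    exact norm_comp_le_mul le_rfl hg

theorem norm_postcomp_le {A B D : Type*} [NormedAddCommGroup A] [NormedSpace ℝ A]
    [NormedAddCommGroup B] [NormedSpace ℝ B] [NormedAddCommGroup D] [NormedSpace ℝ D]
    {f : B →L[ℝ] D} {b : ℝ} (hf : ‖f‖ ≤ b) :
    ‖ContinuousLinearMap.compL ℝ A B D f‖ ≤ b :=
  ContinuousLinearMap.opNorm_le_bound _ ((norm_nonneg _).trans hf) fun _ =>
    norm_comp_le_mul hf le_rfl

end KeyLemma

/-- `f` is `C^j` on `s`, and its derivatives of order at most `j`, taken as multilinear maps with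
the operator norm, are bounded by `K` on `s`. It is used for open `s` only. -/
def BddCk {A B : Type*} [NormedAddCommGroup A] [NormedSpace ℝ A] [NormedAddCommGroup B]
    [NormedSpace ℝ B] (j : ℕ) (K : ℝ) (f : A → B) (s : Set A) : Prop :=
  ContDiffOn ℝ j f s ∧ ∀ i ≤ j, ∀ z ∈ s, ‖iteratedFDeriv ℝ i f z‖ ≤ K

namespace BddCk

variable {A B D E : Type*} [NormedAddCommGroup A] [NormedSpace ℝ A]
  [NormedAddCommGroup B] [NormedSpace ℝ B] [NormedAddCommGroup D] [NormedSpace ℝ D]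
  [NormedAddCommGroup E] [NormedSpace ℝ E]
  {j : ℕ} {K K' : ℝ} {f g : A → B} {s t : Set A}

theorem mono (h : BddCk j K f s) (hK : K ≤ K') : BddCk j K' f s :=
  ⟨h.1, fun i hi z hz => (h.2 i hi z hz).trans hK⟩

theorem mono_order {j' : ℕ} (h : BddCk j K f s) (hj : j' ≤ j) : BddCk j' K f s :=
  ⟨h.1.of_le (by exact_mod_cast hj), fun i hi z hz => h.2 i (hi.trans hj) z hz⟩

theorem mono_set (h : BddCk j K f s) (ht : t ⊆ s) : BddCk j K f t :=
  ⟨h.1.mono ht, fun i hi z hz => h.2 i hi z (ht hz)⟩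

theorem congr (h : BddCk j K f s) (hs : IsOpen s) (hfg : EqOn g f s) : BddCk j K g s := by
  refine ⟨h.1.congr hfg, fun i hi z hz => ?_⟩
  have : g =ᶠ[nhds z] f := Filter.eventuallyEq_of_mem (hs.mem_nhds hz) hfg
  rw [(this.iteratedFDeriv ℝ i).eq_of_nhds]
  exact h.2 i hi z hz

theorem norm_le (h : BddCk j K f s) {z : A} (hz : z ∈ s) : ‖f z‖ ≤ K := by
  simpa using h.2 0 (Nat.zero_le _) z hz

theorem norm_fderiv_le (h : BddCk j K f s) (hj : 1 ≤ j) {z : A} (hz : z ∈ s) :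
    ‖fderiv ℝ f z‖ ≤ K := by
  simpa [norm_iteratedFDeriv_one] using h.2 1 hj z hz

theorem differentiableAt (h : BddCk j K f s) (hj : 1 ≤ j) (hs : IsOpen s) {z : A} (hz : z ∈ s) :
    DifferentiableAt ℝ f z :=
  ((h.1.contDiffAt (hs.mem_nhds hz)).differentiableAt
    (by exact_mod_cast (Nat.one_le_iff_ne_zero.mp hj)))

/-- On a convex set, `f` is Lipschitz with the bound on its derivatives as constant. -/
theorem norm_sub_le (h : BddCk j K f s) (hj : 1 ≤ j) (hs : IsOpen s) (hc : Convex ℝ s)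
    {z w : A} (hz : z ∈ s) (hw : w ∈ s) : ‖f z - f w‖ ≤ K * ‖z - w‖ :=
  hc.norm_image_sub_le_of_norm_fderiv_le (fun _ hx => h.differentiableAt hj hs hx)
    (fun _ hx => h.norm_fderiv_le hj hx) hw hz

theorem fderiv (h : BddCk (j + 1) K f s) (hs : IsOpen s) : BddCk j K (fderiv ℝ f) s := by
  refine ⟨h.1.fderiv_of_isOpen hs (by norm_cast), fun i hi z hz => ?_⟩
  rw [norm_iteratedFDeriv_fderiv]
  exact h.2 (i + 1) (by omega) z hz

theorem of_fderiv (hs : IsOpen s) (hd : ∀ z ∈ s, DifferentiableAt ℝ f z)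
    (hb : ∀ z ∈ s, ‖f z‖ ≤ K) (h : BddCk j K (_root_.fderiv ℝ f) s) : BddCk (j + 1) K f s := by
  refine ⟨?_, fun i hi z hz => ?_⟩
  · have := (contDiffOn_succ_iff_fderiv_of_isOpen (𝕜 := ℝ) (n := (j : ℕ∞ω)) (f := f) hs).2
      ⟨fun z hz => (hd z hz).differentiableWithinAt, by simp, h.1⟩
    exact_mod_cast this
  · rcases i with _ | i
    · simpa using hb z hz
    · rw [← norm_iteratedFDeriv_fderiv]
      exact h.2 i (by omega) z hz

theorem const (c : B) (hc : ‖c‖ ≤ K) : BddCk j K (fun _ : A => c) s := by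
  refine ⟨contDiffOn_const, fun i _ z _ => ?_⟩
  rcases i with _ | i
  · simpa using hc
  · rw [iteratedFDeriv_succ_const]
    simpa using (norm_nonneg c).trans hc

theorem clm (L : A →L[ℝ] B) (hs : IsOpen s) (hL : ‖L‖ ≤ 1) (hK : 1 ≤ K)
    (hb : ∀ z ∈ s, ‖z‖ ≤ K) : BddCk j K L s := by
  have hb' : ∀ z ∈ s, ‖L z‖ ≤ K := fun z hz =>
    (L.le_of_opNorm_le hL z).trans (by simpa using hb z hz)
  rcases j with _ | j
  · refine ⟨L.contDiff.contDiffOn, fun i hi z hz => ?_⟩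
    obtain rfl : i = 0 := by omega
    simpa using hb' z hz
  · refine of_fderiv hs (fun z _ => L.differentiableAt) hb' ?_
    have : _root_.fderiv ℝ L = fun _ => L := by ext1 z; exact L.fderiv
    rw [this]
    exact const L (hL.trans hK)

theorem fst {s : Set (A × B)} (hs : IsOpen s) (hK : 1 ≤ K) (hb : ∀ z ∈ s, ‖z‖ ≤ K) :
    BddCk j K (fun q : A × B => q.1) s :=
  clm (ContinuousLinearMap.fst ℝ A B) hs (ContinuousLinearMap.norm_fst_le ℝ A B) hK hb

theorem snd {s : Set (A × B)} (hs : IsOpen s) (hK : 1 ≤ K) (hb : ∀ z ∈ s, ‖z‖ ≤ K) :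
    BddCk j K (fun q : A × B => q.2) s :=
  clm (ContinuousLinearMap.snd ℝ A B) hs (ContinuousLinearMap.norm_snd_le ℝ A B) hK hb

theorem clm_comp (h : BddCk j K f s) (hs : IsOpen s) (L : B →L[ℝ] D) (hL : ‖L‖ ≤ K') :
    BddCk j (K' * K) (fun z => L (f z)) s := by
  refine ⟨L.contDiff.comp_contDiffOn h.1, fun i hi z hz => ?_⟩
  have := L.norm_iteratedFDeriv_comp_left (h.1.contDiffAt (hs.mem_nhds hz))
    (n := i) (by exact_mod_cast hi)
  refine this.trans ?_
  exact mul_le_mul hL (h.2 i hi z hz) (norm_nonneg _) ((norm_nonneg _).trans hL)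

/-- Composition with a linear map of norm at most one keeps the bound. -/
theorem clm_comp_one (h : BddCk j K f s) (hs : IsOpen s) (L : B →L[ℝ] D) (hL : ‖L‖ ≤ 1) :
    BddCk j K (fun z => L (f z)) s := by
  simpa using h.clm_comp hs L hL

theorem add (h : BddCk j K f s) (h' : BddCk j K' g s) (hs : IsOpen s) :
    BddCk j (K + K') (fun z => f z + g z) s := by
  refine ⟨h.1.add h'.1, fun i hi z hz => ?_⟩
  have h1 := (h.1.contDiffAt (hs.mem_nhds hz)).of_le (m := i) (by exact_mod_cast hi)
  have h2 := (h'.1.contDiffAt (hs.mem_nhds hz)).of_le (m := i) (by exact_mod_cast hi)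
  have := iteratedFDeriv_add_apply h1 h2
  rw [show (fun z => f z + g z) = f + g from rfl, this]
  exact (norm_add_le _ _).trans (add_le_add (h.2 i hi z hz) (h'.2 i hi z hz))

theorem neg (h : BddCk j K f s) (hs : IsOpen s) : BddCk j K (fun z => -f z) s := by
  have := h.clm_comp_one hs (-ContinuousLinearMap.id ℝ B)
    (by rw [norm_neg]; exact ContinuousLinearMap.norm_id_le)
  simpa using this

theorem sub (h : BddCk j K f s) (h' : BddCk j K' g s) (hs : IsOpen s) :
    BddCk j (K + K') (fun z => f z - g z) s := by
  simpa [sub_eq_add_neg] using h.add (h'.neg hs) hs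

theorem prodMk {g : A → D} (h : BddCk j K f s) (h' : BddCk j K' g s) (hs : IsOpen s) :
    BddCk j (K + K') (fun z => (f z, g z)) s := by
  have := (h.clm_comp_one hs (ContinuousLinearMap.inl ℝ B D)
    (ContinuousLinearMap.norm_inl_le_one ℝ B D)).add
    (h'.clm_comp_one hs (ContinuousLinearMap.inr ℝ B D)
      (ContinuousLinearMap.norm_inr_le_one ℝ B D)) hs
  simpa using this

theorem bilin {g : A → D} (h : BddCk j K f s) (h' : BddCk j K' g s) (hs : IsOpen s)
    (L : B →L[ℝ] D →L[ℝ] E) (hL : ‖L‖ ≤ 1) :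
    BddCk j (2 ^ j * (K * K')) (fun z => L (f z) (g z)) s := by
  refine ⟨L.isBoundedBilinearMap.contDiff.comp_contDiffOn (h.1.prodMk h'.1), fun i hi z hz => ?_⟩
  have hK : 0 ≤ K := (norm_nonneg _).trans (h.norm_le hz)
  have hK' : 0 ≤ K' := (norm_nonneg _).trans (h'.norm_le hz)
  have := L.norm_iteratedFDerivWithin_le_of_bilinear_of_le_one h.1 h'.1 hs.uniqueDiffOn hz
    (n := i) (by exact_mod_cast hi) hL
  rw [iteratedFDerivWithin_of_isOpen i hs hz] at this
  refine this.trans ?_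
  calc _ ≤ ∑ l ∈ Finset.range (i + 1), (i.choose l : ℝ) * (K * K') := by
        refine Finset.sum_le_sum fun l hl => ?_
        have hl' : l ≤ i := by simpa [Nat.lt_succ_iff] using hl
        rw [iteratedFDerivWithin_of_isOpen l hs hz, iteratedFDerivWithin_of_isOpen _ hs hz,
          mul_assoc]
        gcongr
        · exact h.2 l (by omega) z hz
        · exact h'.2 _ (by omega) z hz
    _ = 2 ^ i * (K * K') := by
        rw [← Finset.sum_mul]
        congr 1
        exact_mod_cast Nat.sum_range_choose i
    _ ≤ _ := by gcongr; norm_num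

theorem comp {g : B → D} {t : Set B} (h : BddCk j K g t) (h' : BddCk j K' f s) (hs : IsOpen s)
    (ht : IsOpen t) (hst : MapsTo f s t) (hK' : 1 ≤ K') :
    BddCk j (j.factorial * K * K' ^ j) (fun z => g (f z)) s := by
  refine ⟨h.1.comp h'.1 hst, fun i hi z hz => ?_⟩
  have hK : 0 ≤ K := (norm_nonneg _).trans (h.norm_le (hst hz))
  have := norm_iteratedFDerivWithin_comp_le (n := i) h.1 h'.1 (by exact_mod_cast hi)
    ht.uniqueDiffOn hs.uniqueDiffOn hst hz (C := K) (D := K')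
    (fun l hl => by
      rw [iteratedFDerivWithin_of_isOpen l ht (hst hz)]
      exact h.2 l (by omega) _ (hst hz))
    (fun l hl1 hl => by
      rw [iteratedFDerivWithin_of_isOpen l hs hz]
      exact (h'.2 l (by omega) _ hz).trans (le_self_pow₀ hK' (by omega)))
  rw [iteratedFDerivWithin_of_isOpen i hs hz] at this
  refine this.trans ?_
  gcongr

/-- Composition of continuous linear maps that depend on a parameter. -/
theorem clm_mul {f : A → D →L[ℝ] E} {g : A → B →L[ℝ] D} (h : BddCk j K f s)
    (h' : BddCk j K' g s) (hs : IsOpen s) :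
    BddCk j (2 ^ j * (K * K')) (fun z => (f z).comp (g z)) s :=
  h.bilin h' hs (ContinuousLinearMap.compL ℝ B D E) (ContinuousLinearMap.norm_compL_le ℝ B D E)

theorem clm_apply {f : A → B →L[ℝ] D} {g : A → B} (h : BddCk j K f s)
    (h' : BddCk j K' g s) (hs : IsOpen s) :
    BddCk j (2 ^ j * (K * K')) (fun z => f z (g z)) s :=
  h.bilin h' hs (ContinuousLinearMap.id ℝ (B →L[ℝ] D)) ContinuousLinearMap.norm_id_le

/-- The bounds on the derivatives of the inverse come from `(T⁻¹)' = -T⁻¹ T' T⁻¹`, by induction on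
the order. -/
theorem ringInverse (j : ℕ) (K : ℝ) :
    ∃ K', ∀ {A B : Type} [NormedAddCommGroup A] [NormedSpace ℝ A] [NormedAddCommGroup B]
      [NormedSpace ℝ B] [CompleteSpace B] {s : Set A} {T : A → B →L[ℝ] B},
      IsOpen s → BddCk j K T s → (∀ z ∈ s, IsUnit (T z)) →
      (∀ z ∈ s, ‖Ring.inverse (T z)‖ ≤ K) → BddCk j K' (fun z => Ring.inverse (T z)) s := by
  induction j with
  | zero =>
    refine ⟨K, fun {A B} _ _ _ _ _ {s T} hs hT hu hb => ⟨fun z hz => ?_, fun i hi z hz => ?_⟩⟩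
    · obtain ⟨u, hu⟩ := hu z hz
      have h1 : ContDiffAt ℝ 0 Ring.inverse (T z) := hu ▸ contDiffAt_ringInverse ℝ u
      exact h1.comp_contDiffWithinAt z (hT.1 z hz)
    · obtain rfl : i = 0 := by omega
      simpa using hb z hz
  | succ j ih =>
    obtain ⟨K1, h1⟩ := ih
    refine ⟨max K (2 ^ j * (2 ^ j * (K1 * K1) * K)), fun {A B} _ _ _ _ _ {s T} hs hT hu hb => ?_⟩
    have hI := h1 hs (hT.mono_order (Nat.le_succ j)) hu hb
    have hder : ∀ z ∈ s, HasFDerivAt (fun z => Ring.inverse (T z))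
        ((-ContinuousLinearMap.mulLeftRight ℝ (B →L[ℝ] B) (Ring.inverse (T z))
          (Ring.inverse (T z))).comp (_root_.fderiv ℝ T z)) z := by
      intro z hz
      obtain ⟨u, hu⟩ := hu z hz
      have h2 := hasFDerivAt_ringInverse (𝕜 := ℝ) u
      rw [← Ring.inverse_unit, hu] at h2
      exact h2.comp z (hT.differentiableAt (by omega) hs hz).hasFDerivAt
    refine of_fderiv hs (fun z hz => (hder z hz).differentiableAt)
      (fun z hz => (hb z hz).trans (le_max_left _ _)) ?_
    have h3 := ((hI.bilin hI hs _ (ContinuousLinearMap.opNorm_mulLeftRight_le ℝ (B →L[ℝ] B))).neg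
      hs).clm_mul (hT.fderiv hs) hs
    exact (h3.mono (le_max_right _ _)).congr hs fun z hz => (hder z hz).fderiv

/-- The bounds on the derivatives of an implicit function come from `f' = -(∂₂G)⁻¹ ∂₁G`, evaluated
at `(x, f x)`, by induction on the order. -/
theorem of_implicit (j : ℕ) (K : ℝ) :
    ∃ K', ∀ {A B : Type} [NormedAddCommGroup A] [NormedSpace ℝ A] [NormedAddCommGroup B]
      [NormedSpace ℝ B] [CompleteSpace B] {U : Set A} {V : Set (A × B)} {G : A × B → B} {f : A → B},
      IsOpen U → IsOpen V → BddCk j K G V → (∀ x ∈ U, ‖x‖ ≤ K) → (∀ x ∈ U, (x, f x) ∈ V) →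
      (∀ x ∈ U, G (x, f x) = 0) → (∀ x ∈ U, DifferentiableAt ℝ f x) → (∀ x ∈ U, ‖f x‖ ≤ K) →
      (∀ x ∈ U, IsUnit ((_root_.fderiv ℝ G (x, f x)).comp (ContinuousLinearMap.inr ℝ A B))) →
      (∀ x ∈ U, ‖Ring.inverse
        ((_root_.fderiv ℝ G (x, f x)).comp (ContinuousLinearMap.inr ℝ A B))‖ ≤ K) →
      BddCk j K' f U := by
  induction j with
  | zero =>
    refine ⟨K, fun {A B} _ _ _ _ _ {U V G f} hU hV hG hx hf h0 hd hb _ _ =>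
      ⟨?_, fun i hi z hz => ?_⟩⟩
    · exact contDiffOn_zero.2 fun x hx => (hd x hx).continuousAt.continuousWithinAt
    · obtain rfl : i = 0 := by omega
      simpa using hb z hz
  | succ j ih =>
    obtain ⟨K1, h1⟩ := ih
    set K2 : ℝ := j.factorial * K * (max 1 K + K1) ^ j with hK2
    obtain ⟨K3, h3⟩ := ringInverse j (max K K2)
    refine ⟨max K (2 ^ j * (K3 * K2)),
      fun {A B} _ _ _ _ _ {U V G f} hU hV hG hx hf h0 hd hb hu hinv => ?_⟩
    rcases U.eq_empty_or_nonempty with rfl | ⟨x0, hx0⟩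
    · exact ⟨by simp [contDiffOn_empty], by simp⟩
    have hfj := h1 hU hV (hG.mono_order (Nat.le_succ j)) hx hf h0 hd hb hu hinv
    have hK1 : 0 ≤ K1 := (norm_nonneg _).trans (hfj.norm_le hx0)
    have hid : BddCk j (max 1 K) (fun x : A => x) U :=
      clm (ContinuousLinearMap.id ℝ A) hU ContinuousLinearMap.norm_id_le (le_max_left _ _)
        fun z hz => (hx z hz).trans (le_max_right _ _)
    have hpair := hid.prodMk hfj hU
    have hDG : BddCk j K2 (fun x => _root_.fderiv ℝ G (x, f x)) U :=
      (hG.fderiv hV).comp hpair hU hV hf (le_add_of_le_of_nonneg (le_max_left _ _) hK1)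
    have hT : BddCk j K2 (fun x => (_root_.fderiv ℝ G (x, f x)).comp
        (ContinuousLinearMap.inr ℝ A B)) U := by
      exact hDG.clm_comp_one hU _
        (KeyLemma.norm_precomp_le (ContinuousLinearMap.norm_inr_le_one ℝ A B))
    have hS : BddCk j K2 (fun x => (_root_.fderiv ℝ G (x, f x)).comp
        (ContinuousLinearMap.inl ℝ A B)) U := by
      exact hDG.clm_comp_one hU _
        (KeyLemma.norm_precomp_le (ContinuousLinearMap.norm_inl_le_one ℝ A B))
    have hI := h3 hU (hT.mono (le_max_right _ _)) hu
      (fun z hz => (hinv z hz).trans (le_max_left _ _))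
    have hder : ∀ x ∈ U, _root_.fderiv ℝ f x = -((Ring.inverse
        ((_root_.fderiv ℝ G (x, f x)).comp (ContinuousLinearMap.inr ℝ A B))).comp
        ((_root_.fderiv ℝ G (x, f x)).comp (ContinuousLinearMap.inl ℝ A B))) := by
      intro x hx
      have e1 : HasFDerivAt (fun x => G (x, f x)) ((_root_.fderiv ℝ G (x, f x)).comp
          ((ContinuousLinearMap.id ℝ A).prod (_root_.fderiv ℝ f x))) x :=
        HasFDerivAt.comp x (hG.differentiableAt (by omega) hV (hf x hx)).hasFDerivAt
          ((hasFDerivAt_id x).prodMk (hd x hx).hasFDerivAt)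
      have e2 : HasFDerivAt (fun x => G (x, f x)) (0 : A →L[ℝ] B) x :=
        (hasFDerivAt_const (0 : B) x).congr_of_eventuallyEq
          (Filter.eventuallyEq_of_mem (hU.mem_nhds hx) h0)
      have e3 := e1.unique e2
      set T := (_root_.fderiv ℝ G (x, f x)).comp (ContinuousLinearMap.inr ℝ A B) with hTdef
      have e4 : T.comp (_root_.fderiv ℝ f x) =
          -(_root_.fderiv ℝ G (x, f x)).comp (ContinuousLinearMap.inl ℝ A B) := by
        ext a
        have := congrArg (fun φ : A →L[ℝ] B => φ a) e3
        simp only [ContinuousLinearMap.comp_apply, ContinuousLinearMap.prod_apply,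
          zero_apply, ContinuousLinearMap.id_apply] at this
        have h6 : (a, _root_.fderiv ℝ f x a) = (a, 0) + ((0 : A), _root_.fderiv ℝ f x a) := by simp
        rw [h6, map_add] at this
        simpa [hTdef] using eq_neg_of_add_eq_zero_right this
      have e5 : (Ring.inverse T).comp T = ContinuousLinearMap.id ℝ B :=
        Ring.inverse_mul_cancel T (hu x hx)
      rw [← ContinuousLinearMap.comp_neg, ← e4, ← ContinuousLinearMap.comp_assoc, e5,
        ContinuousLinearMap.id_comp]
    refine of_fderiv hU hd (fun z hz => (hb z hz).trans (le_max_left _ _)) ?_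
    exact (((hI.clm_mul hS hU).neg hU).mono (le_max_right _ _)).congr hU hder

/-- The implicit function theorem with bounds: if `y ↦ y - G (x, y)` is a contraction with constant
`1/2` on a ball and `G (x, 0)` is small, then `G (x, y) = 0` has exactly one solution `y = f x` in
that ball, and the bounds on the derivatives of `f` depend only on those of `G`. -/
theorem exists_implicit {j : ℕ} (hj : 1 ≤ j) (K : ℝ) :
    ∃ K', ∀ {A B : Type} [NormedAddCommGroup A] [NormedSpace ℝ A] [CompleteSpace A]
      [NormedAddCommGroup B] [NormedSpace ℝ B] [CompleteSpace B]
      {U : Set A} {b : ℝ} {G : A × B → B},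
      IsOpen U → 0 < b → b ≤ 1 → (∀ x ∈ U, ‖x‖ ≤ 1) → BddCk j K G (U ×ˢ ball 0 b) →
      (∀ x ∈ U, ∀ y ∈ ball (0 : B) b, ∀ y' ∈ ball (0 : B) b,
        ‖(y - G (x, y)) - (y' - G (x, y'))‖ ≤ 1 / 2 * ‖y - y'‖) →
      (∀ x ∈ U, ‖G (x, 0)‖ < b / 2) →
      ∃ f : A → B, (∀ x ∈ U, f x ∈ ball 0 b ∧ G (x, f x) = 0 ∧ ‖f x‖ ≤ 2 * ‖G (x, 0)‖) ∧
        (∀ x ∈ U, ∀ y ∈ ball 0 b, G (x, y) = 0 → y = f x) ∧ BddCk j K' f U := by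
  obtain ⟨K', hK'⟩ := of_implicit j (max 2 K)
  refine ⟨K', fun {A B} _ _ _ _ _ _ {U b G} hU hb hb1 hU1 hG hlip h0 => ?_⟩
  have hV : IsOpen (U ×ˢ ball (0 : B) b) := hU.prod isOpen_ball
  have hex : ∀ x ∈ U, ∃ y, y ∈ ball (0 : B) b ∧ G (x, y) = 0 ∧ ‖y‖ ≤ 2 * ‖G (x, 0)‖ := by
    intro x hx
    set r := 2 * ‖G (x, 0)‖ with hr
    have hrb : r < b := by have := h0 x hx; linarith
    have hsub : closedBall (0 : B) r ⊆ ball 0 b := closedBall_subset_ball hrb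
    have hmaps : MapsTo (fun y => y - G (x, y)) (closedBall (0 : B) r) (closedBall (0 : B) r) := by
      intro y hy
      have := hlip x hx y (hsub hy) 0 (mem_ball_self hb)
      rw [mem_closedBall_zero_iff] at hy ⊢
      have h2 : y - G (x, y) = (y - G (x, y) - (0 - G (x, 0))) - G (x, 0) := by abel
      change ‖y - G (x, y)‖ ≤ r
      rw [h2]
      refine (_root_.norm_sub_le _ _).trans ?_
      rw [sub_zero] at this
      linarith
    have hcon : ContractingWith (1 / 2) (hmaps.restrict _ _ _) := by
      refine ⟨by rw [← NNReal.coe_lt_coe]; norm_num, LipschitzWith.of_dist_le_mul fun y y' => ?_⟩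
      have := hlip x hx y (hsub y.2) y' (hsub y'.2)
      simpa [Subtype.dist_eq, dist_eq_norm] using this
    obtain ⟨y, hy, hfix, -⟩ := hcon.exists_fixedPoint' (isClosed_closedBall.isComplete) hmaps
      (x := 0) (mem_closedBall_self (by positivity)) (edist_ne_top _ _)
    refine ⟨y, hsub hy, ?_, by simpa using hy⟩
    have : y - G (x, y) = y := hfix
    simpa using this
  classical
  choose! f hf using hex
  have huniq : ∀ x ∈ U, ∀ y ∈ ball (0 : B) b, G (x, y) = 0 → y = f x := by
    intro x hx y hy hy0
    have := hlip x hx y hy (f x) (hf x hx).1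
    rw [hy0, (hf x hx).2.1, sub_zero, sub_zero] at this
    have h2 : ‖y - f x‖ = 0 := le_antisymm (by linarith) (norm_nonneg _)
    exact sub_eq_zero.1 (norm_eq_zero.1 h2)
  have hmem : ∀ x ∈ U, (x, f x) ∈ U ×ˢ ball (0 : B) b := fun x hx => ⟨hx, (hf x hx).1⟩
  have hT : ∀ x ∈ U, ‖(1 : B →L[ℝ] B) -
      (_root_.fderiv ℝ G (x, f x)).comp (ContinuousLinearMap.inr ℝ A B)‖ ≤ 1 / 2 := by
    intro x hx
    have h1 : HasFDerivAt (fun y => y - G (x, y)) ((1 : B →L[ℝ] B) -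
        (_root_.fderiv ℝ G (x, f x)).comp (ContinuousLinearMap.inr ℝ A B)) (f x) :=
      (hasFDerivAt_id (f x)).sub (HasFDerivAt.comp (f x)
        (hG.differentiableAt hj hV (hmem x hx)).hasFDerivAt (hasFDerivAt_prodMk_right x (f x)))
    refine h1.le_of_lip' (by norm_num) ?_
    filter_upwards [isOpen_ball.mem_nhds (hf x hx).1] with y hy
    exact hlip x hx y hy _ (hf x hx).1
  have hunit : ∀ x ∈ U, IsUnit ((_root_.fderiv ℝ G (x, f x)).comp
      (ContinuousLinearMap.inr ℝ A B)) := by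
    intro x hx
    have := isUnit_one_sub_of_norm_lt_one ((hT x hx).trans_lt (by norm_num : (1 / 2 : ℝ) < 1))
    simpa using this
  have hinv : ∀ x ∈ U, ‖Ring.inverse ((_root_.fderiv ℝ G (x, f x)).comp
      (ContinuousLinearMap.inr ℝ A B))‖ ≤ max 2 K := by
    intro x hx
    refine le_trans ?_ (le_max_left 2 K)
    set T := (_root_.fderiv ℝ G (x, f x)).comp (ContinuousLinearMap.inr ℝ A B)
    refine ContinuousLinearMap.opNorm_le_bound _ zero_le_two fun w => ?_
    set y := Ring.inverse T w with hy
    have h1 : T y = w :=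
      congrArg (fun φ : B →L[ℝ] B => φ w) (Ring.mul_inverse_cancel T (hunit x hx))
    have h2 : ‖((1 : B →L[ℝ] B) - T) y‖ ≤ 1 / 2 * ‖y‖ :=
      ContinuousLinearMap.le_of_opNorm_le _ (hT x hx) y
    have h3 : y = ((1 : B →L[ℝ] B) - T) y + w := by simp [h1]
    have h4 : ‖y‖ ≤ ‖((1 : B →L[ℝ] B) - T) y‖ + ‖w‖ := by
      conv_lhs => rw [h3]
      exact norm_add_le _ _
    linarith
  have hdiff : ∀ x ∈ U, DifferentiableAt ℝ f x := by
    intro x hx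
    have h1 : ContDiffAt ℝ j G (x, f x) := hG.1.contDiffAt (hV.mem_nhds (hmem x hx))
    have h2 : HasStrictFDerivAt G (_root_.fderiv ℝ G (x, f x)) (x, f x) :=
      h1.hasStrictFDerivAt (by exact_mod_cast (Nat.one_le_iff_ne_zero.mp hj))
    have h3 : ((_root_.fderiv ℝ G (x, f x)).comp
        (ContinuousLinearMap.inr ℝ A B)).IsInvertible := by
      obtain ⟨u, hu⟩ := hunit x hx
      exact ⟨ContinuousLinearEquiv.ofUnit u, by rw [← hu]; rfl⟩
    have h4 := (h2.hasStrictFDerivAt_implicitFunctionOfProdDomain h3).differentiableAt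
    refine h4.congr_of_eventuallyEq ?_
    have h5 := h2.tendsto_implicitFunctionOfProdDomain h3
    filter_upwards [hU.mem_nhds hx, h5.eventually (isOpen_ball.mem_nhds (hf x hx).1),
      h2.eventually_apply_implicitFunctionOfProdDomain h3] with x' hx' hb' he
    exact (huniq x' hx' _ hb' (he.trans (hf x hx).2.1)).symm
  refine ⟨f, hf, huniq, hK' hU hV (hG.mono (le_max_right _ _)) (fun x hx => (hU1 x hx).trans
    (one_le_two.trans (le_max_left _ _))) hmem (fun x hx => (hf x hx).2.1) hdiff
    (fun x hx => ?_) hunit hinv⟩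
  have := mem_ball_zero_iff.1 (hf x hx).1
  exact (this.le.trans hb1).trans (one_le_two.trans (le_max_left _ _))

end BddCk

namespace KeyLemma

/-! ### Coordinates, gradient and Hessian -/

variable {d m : ℕ}

/-- The inclusion `x ↦ (x, 0)`. -/
def inlE (d m : ℕ) : E (Fin d) →L[ℝ] E (Fin d ⊕ Fin m) :=
  LinearMap.toContinuousLinearMap
    { toFun := fun x => pt x 0
      map_add' := fun x y => by ext i; rcases i with i | i <;> simp [pt]
      map_smul' := fun c x => by ext i; rcases i with i | i <;> simp [pt] }

/-- The inclusion `y ↦ (0, y)`. -/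
def inrE (d m : ℕ) : E (Fin m) →L[ℝ] E (Fin d ⊕ Fin m) :=
  LinearMap.toContinuousLinearMap
    { toFun := fun y => pt 0 y
      map_add' := fun x y => by ext i; rcases i with i | i <;> simp [pt]
      map_smul' := fun c x => by ext i; rcases i with i | i <;> simp [pt] }

/-- The projection `(x, y) ↦ x`. -/
def fstE (d m : ℕ) : E (Fin d ⊕ Fin m) →L[ℝ] E (Fin d) :=
  LinearMap.toContinuousLinearMap
    { toFun := fun z => WithLp.toLp 2 fun i => z (Sum.inl i)
      map_add' := fun x y => by ext i; simp
      map_smul' := fun c x => by ext i; simp }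

/-- The projection `(x, y) ↦ y`. -/
def sndE (d m : ℕ) : E (Fin d ⊕ Fin m) →L[ℝ] E (Fin m) :=
  LinearMap.toContinuousLinearMap
    { toFun := fun z => WithLp.toLp 2 fun i => z (Sum.inr i)
      map_add' := fun x y => by ext i; simp
      map_smul' := fun c x => by ext i; simp }

theorem pt_eq (x : E (Fin d)) (y : E (Fin m)) : pt x y = inlE d m x + inrE d m y := by
  ext i; rcases i with i | i <;> simp [pt, inlE, inrE]

@[simp] theorem fstE_inlE (x : E (Fin d)) : fstE d m (inlE d m x) = x := by
  ext i; simp [fstE, inlE, pt]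

@[simp] theorem fstE_inrE (y : E (Fin m)) : fstE d m (inrE d m y) = 0 := by
  ext i; simp [fstE, inrE, pt]

@[simp] theorem sndE_inlE (x : E (Fin d)) : sndE d m (inlE d m x) = 0 := by
  ext i; simp [sndE, inlE, pt]

@[simp] theorem sndE_inrE (y : E (Fin m)) : sndE d m (inrE d m y) = y := by
  ext i; simp [sndE, inrE, pt]

@[simp] theorem fstE_pt (x : E (Fin d)) (y : E (Fin m)) : fstE d m (pt x y) = x := by
  simp [pt_eq]

@[simp] theorem sndE_pt (x : E (Fin d)) (y : E (Fin m)) : sndE d m (pt x y) = y := by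
  simp [pt_eq]

theorem inlE_fstE_add (z : E (Fin d ⊕ Fin m)) :
    inlE d m (fstE d m z) + inrE d m (sndE d m z) = z := by
  ext i; rcases i with i | i <;> simp [fstE, sndE, inlE, inrE, pt]

theorem pt_fstE_sndE (z : E (Fin d ⊕ Fin m)) : pt (fstE d m z) (sndE d m z) = z := by
  rw [pt_eq, inlE_fstE_add]

theorem inner_pt (x x' : E (Fin d)) (y y' : E (Fin m)) :
    inner ℝ (pt x y) (pt x' y') = inner ℝ x x' + inner ℝ y y' := by
  simp [pt, PiLp.inner_apply]

theorem norm_pt_sq (x : E (Fin d)) (y : E (Fin m)) : ‖pt x y‖ ^ 2 = ‖x‖ ^ 2 + ‖y‖ ^ 2 := by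
  simp only [← real_inner_self_eq_norm_sq, inner_pt]

theorem inner_inlE_left (x : E (Fin d)) (z : E (Fin d ⊕ Fin m)) :
    inner ℝ (inlE d m x) z = inner ℝ x (fstE d m z) := by
  have := inner_pt x (fstE d m z) (0 : E (Fin m)) (sndE d m z)
  rwa [pt_fstE_sndE, pt_eq, map_zero, add_zero, inner_zero_left, add_zero] at this

theorem inner_inrE_left (y : E (Fin m)) (z : E (Fin d ⊕ Fin m)) :
    inner ℝ (inrE d m y) z = inner ℝ y (sndE d m z) := by
  have := inner_pt (0 : E (Fin d)) (fstE d m z) y (sndE d m z)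
  rwa [pt_fstE_sndE, pt_eq, map_zero, zero_add, inner_zero_left, zero_add] at this

@[simp] theorem norm_inlE_apply (x : E (Fin d)) : ‖inlE d m x‖ = ‖x‖ := by
  rw [← sq_eq_sq₀ (norm_nonneg _) (norm_nonneg _), ← real_inner_self_eq_norm_sq, inner_inlE_left,
    fstE_inlE, real_inner_self_eq_norm_sq]

@[simp] theorem norm_inrE_apply (y : E (Fin m)) : ‖inrE d m y‖ = ‖y‖ := by
  rw [← sq_eq_sq₀ (norm_nonneg _) (norm_nonneg _), ← real_inner_self_eq_norm_sq, inner_inrE_left,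
    sndE_inrE, real_inner_self_eq_norm_sq]

theorem norm_sq_eq (z : E (Fin d ⊕ Fin m)) :
    ‖z‖ ^ 2 = ‖fstE d m z‖ ^ 2 + ‖sndE d m z‖ ^ 2 := by
  rw [← norm_pt_sq, pt_fstE_sndE]

theorem norm_fstE_apply_le (z : E (Fin d ⊕ Fin m)) : ‖fstE d m z‖ ≤ ‖z‖ := by
  rw [← sq_le_sq₀ (norm_nonneg _) (norm_nonneg _), norm_sq_eq z]
  exact le_add_of_nonneg_right (sq_nonneg _)

theorem norm_sndE_apply_le (z : E (Fin d ⊕ Fin m)) : ‖sndE d m z‖ ≤ ‖z‖ := by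
  rw [← sq_le_sq₀ (norm_nonneg _) (norm_nonneg _), norm_sq_eq z]
  exact le_add_of_nonneg_left (sq_nonneg _)

theorem norm_inlE_le : ‖inlE d m‖ ≤ 1 :=
  ContinuousLinearMap.opNorm_le_bound _ zero_le_one fun x => by simp

theorem norm_inrE_le : ‖inrE d m‖ ≤ 1 :=
  ContinuousLinearMap.opNorm_le_bound _ zero_le_one fun x => by simp

theorem norm_fstE_le : ‖fstE d m‖ ≤ 1 :=
  ContinuousLinearMap.opNorm_le_bound _ zero_le_one fun x => by simpa using norm_fstE_apply_le x

theorem norm_sndE_le : ‖sndE d m‖ ≤ 1 :=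
  ContinuousLinearMap.opNorm_le_bound _ zero_le_one fun x => by simpa using norm_sndE_apply_le x

section Hilbert
variable {A B : Type*} [NormedAddCommGroup A] [InnerProductSpace ℝ A] [CompleteSpace A]
  [NormedAddCommGroup B] [InnerProductSpace ℝ B] [CompleteSpace B]

/-- Taking adjoints, as a real linear map; `ContinuousLinearMap.adjoint` is bundled as a conjugate
linear one. -/
def adjointL (A B : Type*) [NormedAddCommGroup A] [InnerProductSpace ℝ A] [CompleteSpace A]
    [NormedAddCommGroup B] [InnerProductSpace ℝ B] [CompleteSpace B] :
    (A →L[ℝ] B) →L[ℝ] (B →L[ℝ] A) :=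
  LinearMap.mkContinuous
    { toFun := fun L => ContinuousLinearMap.adjoint L
      map_add' := fun L L' => map_add _ L L'
      map_smul' := fun c L => by simp } 1 fun L => by
        rw [one_mul]
        exact (LinearIsometryEquiv.norm_map ContinuousLinearMap.adjoint L).le

@[simp] theorem adjointL_apply (L : A →L[ℝ] B) : adjointL A B L = ContinuousLinearMap.adjoint L :=
  rfl

theorem norm_adjointL_le : ‖adjointL A B‖ ≤ 1 := LinearMap.mkContinuous_norm_le _ zero_le_one _

/-- The Riesz isomorphism from the dual to the space, as a real linear map. -/
def rieszL (A : Type*) [NormedAddCommGroup A] [InnerProductSpace ℝ A] [CompleteSpace A] :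
    (A →L[ℝ] ℝ) →L[ℝ] A :=
  LinearMap.mkContinuous
    { toFun := fun φ => (InnerProductSpace.toDual ℝ A).symm φ
      map_add' := fun L L' => map_add _ L L'
      map_smul' := fun c L => by simp } 1 fun L => by
        rw [one_mul]
        exact (LinearIsometryEquiv.norm_map (InnerProductSpace.toDual ℝ A).symm L).le

theorem norm_rieszL_le : ‖rieszL A‖ ≤ 1 := LinearMap.mkContinuous_norm_le _ zero_le_one _

theorem inner_gradient (F : A → ℝ) (z w : A) : inner ℝ (gradient F z) w = fderiv ℝ F z w :=
  InnerProductSpace.toDual_symm_apply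

theorem bddCk_gradient {j : ℕ} {M : ℝ} {F : A → ℝ} {s : Set A} (h : BddCk (j + 1) M F s)
    (hs : IsOpen s) : BddCk j M (gradient F) s :=
  (h.fderiv hs).clm_comp_one hs (rieszL A) norm_rieszL_le

theorem inner_fderiv_gradient {F : A → ℝ} {z : A} (h : ContDiffAt ℝ 2 F z) (u v : A) :
    inner ℝ (fderiv ℝ (gradient F) z u) v = fderiv ℝ (fderiv ℝ F) z u v := by
  have h1 : DifferentiableAt ℝ (fderiv ℝ F) z :=
    (h.fderiv_right (m := 1) (by norm_num)).differentiableAt (by norm_num)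
  have h2 : fderiv ℝ (gradient F) z = (rieszL A).comp (fderiv ℝ (fderiv ℝ F) z) :=
    ((rieszL A).hasFDerivAt.comp z h1.hasFDerivAt).fderiv
  rw [h2]
  exact InnerProductSpace.toDual_symm_apply

theorem inner_fderiv_gradient_comm {F : A → ℝ} {z : A} (h : ContDiffAt ℝ 2 F z) (u v : A) :
    inner ℝ (fderiv ℝ (gradient F) z u) v = inner ℝ u (fderiv ℝ (gradient F) z v) := by
  rw [real_inner_comm (fderiv ℝ (gradient F) z v) u, inner_fderiv_gradient h,
    inner_fderiv_gradient h]
  exact (h.isSymmSndFDerivAt (by simp)).eq u v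

end Hilbert

section Coordinates
variable {ι : Type} [Fintype ι] [DecidableEq ι]

theorem hessian_eq {F : E ι → ℝ} {z : E ι} (h : ContDiffAt ℝ 2 F z) :
    hessian F z = (fderiv ℝ (gradient F) z : E ι →ₗ[ℝ] E ι) := by
  refine (EuclideanSpace.basisFun ι ℝ).toBasis.ext fun j => ?_
  ext i
  have h1 : (fderiv ℝ (gradient F) z (EuclideanSpace.single j 1)) i =
      fderiv ℝ (fderiv ℝ F) z (EuclideanSpace.single i 1) (EuclideanSpace.single j 1) := by
    rw [← inner_fderiv_gradient h, inner_fderiv_gradient_comm h, EuclideanSpace.inner_single_left]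
    simp
  simp [hessian, mixedPartial, iteratedFDeriv_two_apply, h1, Matrix.toLpLin_apply]

/-- The operator norm of a multilinear map on `ℝ^ι` is bounded by its values at the basis
vectors. -/
theorem norm_le_of_single {G : Type*} [NormedAddCommGroup G] [NormedSpace ℝ G] {j : ℕ}
    (T : ContinuousMultilinearMap ℝ (fun _ : Fin j => E ι) G) {C : ℝ} (hC : 0 ≤ C)
    (h : ∀ σ : Fin j → ι, ‖T fun i => EuclideanSpace.single (σ i) (1 : ℝ)‖ ≤ C) :
    ‖T‖ ≤ (Fintype.card ι : ℝ) ^ j * C := by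
  refine ContinuousMultilinearMap.opNorm_le_bound (by positivity) fun v => ?_
  have h1 : v = fun i => ∑ a : ι, (v i a) • EuclideanSpace.single a (1 : ℝ) := by
    funext i
    have := (EuclideanSpace.basisFun ι ℝ).sum_repr (v i)
    simpa using this.symm
  have h2 : T v =
      ∑ σ : Fin j → ι, T fun i => (v i (σ i)) • EuclideanSpace.single (σ i) (1 : ℝ) := by
    conv_lhs => rw [h1]
    exact T.map_sum (fun i a => (v i a) • EuclideanSpace.single a (1 : ℝ))
  rw [h2]
  refine (norm_sum_le _ _).trans ?_
  have h3 : ∀ σ : Fin j → ι, ‖T fun i => (v i (σ i)) • EuclideanSpace.single (σ i) (1 : ℝ)‖ ≤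
      (∏ i, ‖v i‖) * C := by
    intro σ
    rw [T.map_smul_univ, norm_smul, norm_prod]
    gcongr with i
    · exact PiLp.norm_apply_le (v i) (σ i)
    · exact h σ
  refine (Finset.sum_le_sum fun σ _ => h3 σ).trans ?_
  simp only [Finset.sum_const, Finset.card_univ, Fintype.card_fun, Fintype.card_fin, nsmul_eq_mul]
  push_cast
  exact (by ring : (Fintype.card ι : ℝ) ^ j * ((∏ i, ‖v i‖) * C) = _).le

theorem norm_mixedPartial_le {G : Type*} [NormedAddCommGroup G] [NormedSpace ℝ G] (f : E ι → G)
    {j : ℕ} (σ : Fin j → ι) (z : E ι) : ‖mixedPartial f σ z‖ ≤ ‖iteratedFDeriv ℝ j f z‖ := by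
  refine ((iteratedFDeriv ℝ j f z).le_opNorm _).trans ?_
  simp

theorem _root_.BddCk.partialsBoundedBy {G : Type*} [NormedAddCommGroup G] [NormedSpace ℝ G]
    {f : E ι → G} {j : ℕ} {K : ℝ} {s : Set (E ι)} (h : BddCk j K f s) :
    PartialsBoundedBy j K f s :=
  fun z hz i hi σ => (norm_mixedPartial_le f σ z).trans (h.2 i hi z hz)

theorem PartialsBoundedBy.bddCk {G : Type*} [NormedAddCommGroup G] [NormedSpace ℝ G]
    {f : E ι → G} {j : ℕ} {C : ℝ} {s : Set (E ι)} (h : PartialsBoundedBy j C f s)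
    (hf : ContDiffOn ℝ j f s) :
    BddCk j ((1 + Fintype.card ι : ℝ) ^ j * |C|) f s := by
  refine ⟨hf, fun i hi z hz => ?_⟩
  refine (norm_le_of_single _ (abs_nonneg C)
    fun σ => (h z hz i hi σ).trans (le_abs_self C)).trans ?_
  have h1 : (0 : ℝ) ≤ Fintype.card ι := by positivity
  gcongr
  calc (Fintype.card ι : ℝ) ^ i ≤ (1 + Fintype.card ι : ℝ) ^ i := by gcongr; linarith
    _ ≤ _ := by gcongr; linarith

end Coordinates

/-! ### The gradient and the Hessian at the origin -/

/-- The second-order Taylor formula at the origin, for a function with bounded third derivatives. -/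
theorem abs_taylor_le {A : Type*} [NormedAddCommGroup A] [InnerProductSpace ℝ A] [CompleteSpace A]
    {F : A → ℝ} {M : ℝ} (hF : BddCk 3 M F (ball 0 1)) {z : A} (hz : z ∈ ball (0 : A) 1) :
    |F z - F 0 - inner ℝ (gradient F 0) z - 1 / 2 * inner ℝ (fderiv ℝ (gradient F) 0 z) z| ≤
      M * ‖z‖ ^ 3 := by
  have hz1 : ‖z‖ < 1 := by simpa using hz
  have hM : 0 ≤ M := (norm_nonneg _).trans (hF.norm_le hz)
  have h0 : (0 : A) ∈ ball (0 : A) 1 := mem_ball_self one_pos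
  have hp := bddCk_gradient hF isOpen_ball
  have hH := hp.fderiv isOpen_ball
  set p := gradient F with hpdef
  set H := fderiv ℝ p with hHdef
  have hsub : closedBall (0 : A) ‖z‖ ⊆ ball 0 1 := closedBall_subset_ball hz1
  have hconv := convex_closedBall (0 : A) ‖z‖
  have hmem0 : (0 : A) ∈ closedBall (0 : A) ‖z‖ := mem_closedBall_self (norm_nonneg _)
  have h1 : ∀ w ∈ closedBall (0 : A) ‖z‖, ‖p w - p 0 - H 0 w‖ ≤ M * ‖z‖ * ‖z‖ := by
    intro w hw
    have hw' : ‖w‖ ≤ ‖z‖ := by simpa using hw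
    have hd : ∀ u ∈ closedBall (0 : A) ‖z‖,
        HasFDerivWithinAt (fun u => p u - H 0 u) (H u - H 0) (closedBall (0 : A) ‖z‖) u :=
      fun u hu => ((hp.differentiableAt (by norm_num) isOpen_ball
        (hsub hu)).hasFDerivAt.sub (H 0).hasFDerivAt).hasFDerivWithinAt
    have hb : ∀ u ∈ closedBall (0 : A) ‖z‖, ‖H u - H 0‖ ≤ M * ‖z‖ := by
      intro u hu
      refine (hH.norm_sub_le le_rfl isOpen_ball (convex_ball _ _) (hsub hu) h0).trans ?_
      rw [sub_zero]
      gcongr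
      simpa using hu
    have := hconv.norm_image_sub_le_of_norm_hasFDerivWithin_le hd hb hmem0 hw
    rw [map_zero, sub_zero, sub_zero] at this
    calc _ = ‖p w - H 0 w - p 0‖ := by congr 1; abel
      _ ≤ _ := this
      _ ≤ _ := by gcongr
  have hsymm : ∀ u v, inner ℝ (H 0 u) v = inner ℝ u (H 0 v) :=
    inner_fderiv_gradient_comm
      ((hF.1.contDiffAt (isOpen_ball.mem_nhds h0)).of_le (by norm_num))
  have hd : ∀ u ∈ closedBall (0 : A) ‖z‖,
      HasFDerivWithinAt (fun u => F u - inner ℝ (p 0) u - 1 / 2 * inner ℝ (H 0 u) u)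
        (innerSL ℝ (p u - p 0 - H 0 u)) (closedBall (0 : A) ‖z‖) u := by
    intro u hu
    have e1 : HasFDerivAt F (innerSL ℝ (p u)) u := by
      have := (hF.differentiableAt (by norm_num) isOpen_ball (hsub hu)).hasFDerivAt
      exact this.congr_fderiv (ContinuousLinearMap.ext fun v => (inner_gradient F u v).symm)
    have e2 : HasFDerivAt (fun u => inner ℝ (p 0) u) (innerSL ℝ (p 0)) u :=
      (innerSL ℝ (p 0)).hasFDerivAt
    have e3 := (H 0).hasFDerivAt.inner ℝ (hasFDerivAt_id (𝕜 := ℝ) u)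
    refine HasFDerivAt.hasFDerivWithinAt ?_
    refine ((e1.sub e2).sub (e3.const_mul (1 / 2))).congr_fderiv
      (ContinuousLinearMap.ext fun v => ?_)
    simp only [innerSL_apply_apply, inner_sub_left, sub_apply, smul_apply,
      ContinuousLinearMap.comp_apply,
      ContinuousLinearMap.prod_apply, fderivInnerCLM_apply, ContinuousLinearMap.id_apply, id,
      smul_eq_mul]
    rw [hsymm v u, real_inner_comm (H 0 u) v]
    ring
  have hb : ∀ u ∈ closedBall (0 : A) ‖z‖, ‖innerSL ℝ (p u - p 0 - H 0 u)‖ ≤ M * ‖z‖ * ‖z‖ := by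
    intro u hu
    rw [innerSL_apply_norm]
    exact h1 u hu
  have := hconv.norm_image_sub_le_of_norm_hasFDerivWithin_le hd hb hmem0
    (show z ∈ closedBall (0 : A) ‖z‖ by simp)
  simp only [inner_zero_right, mul_zero, sub_zero, Real.norm_eq_abs] at this
  calc _ = |F z - inner ℝ (p 0) z - 1 / 2 * inner ℝ (H 0 z) z - F 0| := by congr 1; ring
    _ ≤ _ := this
    _ = _ := by ring

/-- If a symmetric operator is bounded below by `-η` and its quadratic form is at most `η` at `u`,
then it is small at `u`. -/
theorem norm_sq_apply_le_of_form_le {A : Type*} [NormedAddCommGroup A] [InnerProductSpace ℝ A]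
    {H : A →L[ℝ] A} (hH : ∀ u v, inner ℝ (H u) v = inner ℝ u (H v)) {M η : ℝ} (hM : ‖H‖ ≤ M)
    (hη : 0 < η) (hlow : ∀ v, -η * ‖v‖ ^ 2 ≤ inner ℝ (H v) v) {u : A}
    (hu : inner ℝ (H u) u ≤ η * ‖u‖ ^ 2) :
    ‖H u + η • u‖ ^ 2 ≤ 2 * η * (M + η) * ‖u‖ ^ 2 := by
  have hM0 : 0 ≤ M := (norm_nonneg _).trans hM
  set v := H u + η • u with hv
  set t : ℝ := (M + η)⁻¹ with ht
  have hMη : 0 < M + η := by linarith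
  have htp : 0 < t := inv_pos.2 hMη
  have htm : t * (M + η) = 1 := inv_mul_cancel₀ hMη.ne'
  have h1 := hlow (u - t • v)
  have h2 : inner ℝ (H v) v ≤ M * ‖v‖ ^ 2 := by
    refine (real_inner_le_norm _ _).trans ?_
    rw [sq, ← mul_assoc]
    gcongr
    exact (H.le_opNorm v).trans (by gcongr)
  have h3 : inner ℝ (H u) v + η * inner ℝ u v = ‖v‖ ^ 2 := by
    rw [← real_inner_self_eq_norm_sq v]
    conv_rhs => rw [hv, inner_add_left, real_inner_smul_left]
  have h4 : inner ℝ (H v) u = inner ℝ (H u) v := by rw [hH v u, real_inner_comm]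
  rw [← real_inner_self_eq_norm_sq (u - t • v)] at h1
  simp only [map_sub, map_smul, inner_sub_left, inner_sub_right, real_inner_smul_left,
    real_inner_smul_right, real_inner_comm u v, h4, real_inner_self_eq_norm_sq] at h1
  have h5 : t ^ 2 * inner ℝ (H v) v ≤ t ^ 2 * (M * ‖v‖ ^ 2) := by gcongr
  have h6 : t ^ 2 * (M * ‖v‖ ^ 2) + t ^ 2 * (η * ‖v‖ ^ 2) = t * ‖v‖ ^ 2 := by
    calc _ = t * (t * (M + η)) * ‖v‖ ^ 2 := by ring
      _ = _ := by rw [htm, mul_one]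
  have h7 : t * ‖v‖ ^ 2 ≤ 2 * η * ‖u‖ ^ 2 := by
    have h8 : t * ‖v‖ ^ 2 = t * inner ℝ (H u) v + η * t * inner ℝ u v := by rw [← h3]; ring
    have h9 : ‖t • v‖ ^ 2 = t ^ 2 * ‖v‖ ^ 2 := by
      rw [norm_smul, mul_pow, Real.norm_eq_abs, sq_abs]
    rw [h9] at h1
    linarith
  calc ‖v‖ ^ 2 = (M + η) * (t * ‖v‖ ^ 2) := by rw [← mul_assoc, mul_comm (M + η), htm, one_mul]
    _ ≤ (M + η) * (2 * η * ‖u‖ ^ 2) := by gcongr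
    _ = _ := by ring

/-- If `F + ρ ^ 2` is nonnegative, at most `C₁ ρ ^ 2` at the origin, and `ρ` is at most the square
of the scale `δ`, then the gradient at the origin is `O(ρ)`, and on the sphere of radius `δ` the
Hessian form agrees with `F + ρ ^ 2` up to `O(δ ^ 3)`. -/
theorem gradient_and_form_estimates {A : Type*} [NormedAddCommGroup A] [InnerProductSpace ℝ A]
    [CompleteSpace A] {F : A → ℝ} {M C₁ ρ δ : ℝ} (hM : 0 ≤ M) (hC₁ : 0 ≤ C₁) (hρ : 0 < ρ)
    (hδ0 : 0 < δ) (hδ1 : δ ≤ 1 / 2) (hρδ : ρ < δ ^ 2) (hF : BddCk 3 M F (ball 0 1))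
    (h0 : F 0 + ρ ^ 2 ≤ C₁ * ρ ^ 2) (hnn : ∀ z ∈ ball (0 : A) 1, 0 ≤ F z + ρ ^ 2) :
    ‖gradient F 0‖ ≤ (C₁ + 2 * M) * ρ ∧ ∀ z, ‖z‖ = δ →
      |1 / 2 * inner ℝ (fderiv ℝ (gradient F) 0 z) z - (F z + ρ ^ 2)| ≤
        (2 * C₁ + 3 * M + 1) * δ * δ ^ 2 := by
  have hT := fun z (hz : z ∈ ball (0 : A) 1) => abs_le.1 (abs_taylor_le hF hz)
  have h0mem : (0 : A) ∈ ball (0 : A) 1 := mem_ball_self one_pos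
  have hHb : ‖fderiv ℝ (gradient F) 0‖ ≤ M :=
    (bddCk_gradient hF isOpen_ball).norm_fderiv_le (by norm_num) h0mem
  have h0' := hnn 0 h0mem
  set p := gradient F 0
  set H := fderiv ℝ (gradient F) 0
  have hρ2 : 0 < ρ ^ 2 := by positivity
  have hρ1 : ρ < 1 := by nlinarith
  have hQ : ∀ z, inner ℝ (H z) z ≤ M * ‖z‖ ^ 2 := fun z => by
    refine (real_inner_le_norm _ _).trans ?_
    rw [sq, ← mul_assoc]
    gcongr
    exact (H.le_opNorm z).trans (by gcongr)
  -- moving by `ρ` against the gradient would make `F + ρ ^ 2` negative if the gradient were large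
  have hgrad : ‖p‖ ≤ (C₁ + 2 * M) * ρ := by
    by_contra! hlt
    have hp0 : 0 < ‖p‖ := lt_of_le_of_lt (by positivity) hlt
    set z : A := -(ρ / ‖p‖) • p with hz
    have hzn : ‖z‖ = ρ := by
      rw [hz, norm_smul, norm_neg, Real.norm_of_nonneg (by positivity), div_mul_cancel₀ _ hp0.ne']
    have hzm : z ∈ ball (0 : A) 1 := by rwa [mem_ball_zero_iff, hzn]
    have e1 := (hT z hzm).2
    have e2 := hnn z hzm
    have e3 : inner ℝ p z = -(ρ * ‖p‖) := by
      rw [hz, real_inner_smul_right, real_inner_self_eq_norm_sq]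
      field_simp
    have e4 := hQ z
    rw [hzn] at e1 e4
    rw [e3] at e1
    have e5 : M * ρ ^ 3 ≤ M * ρ ^ 2 := by
      gcongr ?_ * ?_
      nlinarith
    have e6 : 0 ≤ M * ρ ^ 2 := by positivity
    have e7 : ρ * ‖p‖ ≤ C₁ * ρ ^ 2 + 2 * M * ρ ^ 2 := by linarith [h0]
    nlinarith [mul_lt_mul_of_pos_left hlt hρ]
  refine ⟨hgrad, ?_⟩
  intro z hz
  have hzm : z ∈ ball (0 : A) 1 := by
    rw [mem_ball_zero_iff, hz]; linarith
  have e1 := hT z hzm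
  have e2 : |inner ℝ p z| ≤ (C₁ + 2 * M) * ρ * δ := by
    refine (abs_real_inner_le_norm _ _).trans ?_
    rw [hz]
    gcongr
  have e3 : (C₁ + 2 * M) * ρ * δ ≤ (C₁ + 2 * M) * δ ^ 2 * δ := by gcongr
  have e4 : C₁ * ρ ^ 2 ≤ C₁ * (δ * δ ^ 2) := by
    gcongr
    calc ρ ^ 2 ≤ (δ ^ 2) ^ 2 := by gcongr
      _ = δ * (δ * δ ^ 2) := by ring
      _ ≤ 1 * (δ * δ ^ 2) := by gcongr; linarith
      _ = _ := one_mul _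
  have e5 : 0 ≤ δ * δ ^ 2 := by positivity
  rw [hz] at e1
  rw [abs_le] at e2 ⊢
  have e7 : 0 ≤ C₁ * (δ * δ ^ 2) := by positivity
  have e8 : 0 ≤ M * (δ * δ ^ 2) := by positivity
  have e9 : (2 * C₁ + 3 * M + 1) * δ * δ ^ 2 =
      2 * (C₁ * (δ * δ ^ 2)) + 3 * (M * (δ * δ ^ 2)) + δ * δ ^ 2 := by ring
  have e10 : (C₁ + 2 * M) * δ ^ 2 * δ = C₁ * (δ * δ ^ 2) + 2 * (M * (δ * δ ^ 2)) := by ring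
  have e11 : M * δ ^ 3 = M * (δ * δ ^ 2) := by ring
  rw [e9]
  rw [e10] at e3
  rw [e11] at e1
  constructor <;> linarith [e1.1, e1.2, e2.1, e2.2, h0, h0']

/-- By homogeneity, a lower bound for a quadratic form needs to be checked on one sphere only. -/
theorem le_form_of_sphere {A : Type*} [NormedAddCommGroup A] [InnerProductSpace ℝ A]
    (H : A →L[ℝ] A) {δ a : ℝ} (hδ : 0 < δ) (v : A)
    (h : ∀ t : ℝ, ‖t • v‖ = δ → a * δ ^ 2 ≤ inner ℝ (H (t • v)) (t • v)) :
    a * ‖v‖ ^ 2 ≤ inner ℝ (H v) v := by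
  rcases eq_or_ne v 0 with rfl | hv
  · simp
  have hv' : 0 < ‖v‖ := norm_pos_iff.2 hv
  have h1 := h (δ / ‖v‖) (by
    rw [norm_smul, Real.norm_of_nonneg (by positivity), div_mul_cancel₀ _ hv'.ne'])
  rw [map_smul, real_inner_smul_left, real_inner_smul_right, ← mul_assoc, ← sq] at h1
  have h2 : (δ / ‖v‖) ^ 2 * (a * ‖v‖ ^ 2) = a * δ ^ 2 := by field_simp
  rw [← h2] at h1
  exact le_of_mul_le_mul_left h1 (by positivity)

/-- The two-sided bound on `F` forces, at the origin, a gradient of size `O(ρ)`, a Hessian that is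
coercive in the `y` directions, and a Hessian that nearly vanishes in the `x` directions. -/
theorem exists_estimates_at_zero (M c₁ C₁ : ℝ) (hM : 0 ≤ M) (hc₁ : 0 < c₁) {ε : ℝ} (hε : 0 < ε) :
    ∃ c > 0, ∀ {d m : ℕ} {ρ : ℝ} {F : E (Fin d ⊕ Fin m) → ℝ}, 0 < ρ → ρ < c →
      BddCk 3 M F (ball 0 1) →
      (∀ (x : E (Fin d)) (y : E (Fin m)), pt x y ∈ ball 0 1 →
        c₁ * (‖y‖ ^ 2 + ρ ^ 2) ≤ F (pt x y) + ρ ^ 2 ∧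
        F (pt x y) + ρ ^ 2 ≤ C₁ * (‖y‖ ^ 2 + ρ ^ 2)) →
      ‖gradient F 0‖ ≤ (C₁ + 2 * M) * ρ ∧
      ‖(fderiv ℝ (gradient F) 0).comp (inlE d m)‖ ≤ ε ∧
      ∀ y, c₁ * ‖y‖ ^ 2 ≤ inner ℝ (fderiv ℝ (gradient F) 0 (inrE d m y)) (inrE d m y) := by
  set C := max C₁ 0
  have hC0 : 0 ≤ C := le_max_right _ _
  set κ : ℝ := 2 * C + 3 * M + 1 with hκ
  have hκ0 : 0 < κ := by positivity
  -- the scale at which the Taylor formula is used; the errors are of size `κ δ` relative to `δ ^ 2`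
  set η₀ : ℝ := min (min 1 (ε / 2)) (ε ^ 2 / (8 * (M + 1))) with hη₀
  have hη₀p : 0 < η₀ := by positivity
  set δ : ℝ := min (1 / 2) (min (c₁ / (2 * κ)) (η₀ / (3 * κ))) with hδ
  have hδ0 : 0 < δ := by positivity
  have hδ1 : δ ≤ 1 / 2 := min_le_left _ _
  have hδc : κ * δ ≤ c₁ / 2 := by
    have : δ ≤ c₁ / (2 * κ) := (min_le_right _ _).trans (min_le_left _ _)
    rw [le_div_iff₀ (by positivity)] at this
    linarith
  have hδη : 3 * (κ * δ) ≤ η₀ := by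
    have : δ ≤ η₀ / (3 * κ) := (min_le_right _ _).trans (min_le_right _ _)
    rw [le_div_iff₀ (by positivity)] at this
    linarith
  refine ⟨δ ^ 2, by positivity, fun {d m ρ F} hρ hρδ hF hineq => ?_⟩
  have h0mem : (0 : E (Fin d ⊕ Fin m)) ∈ ball (0 : E (Fin d ⊕ Fin m)) 1 := mem_ball_self one_pos
  have hHb : ‖fderiv ℝ (gradient F) 0‖ ≤ M :=
    (bddCk_gradient hF isOpen_ball).norm_fderiv_le (by norm_num) h0mem
  have hsymm := inner_fderiv_gradient_comm (F := F) (z := 0)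
    ((hF.1.contDiffAt (isOpen_ball.mem_nhds h0mem)).of_le (by norm_num))
  have hρ2 : 0 < ρ ^ 2 := by positivity
  have hpt0 : pt (0 : E (Fin d)) (0 : E (Fin m)) = 0 := by simp [pt_eq]
  have hF0 : F 0 + ρ ^ 2 ≤ C₁ * ρ ^ 2 ∧ 0 ≤ F 0 + ρ ^ 2 := by
    have := hineq 0 0 (by rw [hpt0]; exact h0mem)
    rw [hpt0] at this
    simp only [norm_zero] at this
    constructor
    · nlinarith [this.2]
    · nlinarith [this.1, mul_pos hc₁ hρ2]
  have hC₁ : C = C₁ := max_eq_left (by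
    by_contra hneg
    push Not at hneg
    nlinarith [hF0.1, hF0.2])
  have hFnn : ∀ z ∈ ball (0 : E (Fin d ⊕ Fin m)) 1, 0 ≤ F z + ρ ^ 2 := by
    intro z hz
    have := (hineq (fstE d m z) (sndE d m z) (by rwa [pt_fstE_sndE])).1
    rw [pt_fstE_sndE] at this
    exact le_trans (by positivity) this
  obtain ⟨hgrad, herr⟩ := gradient_and_form_estimates hM (hC₁ ▸ hC0) hρ hδ0 hδ1 hρδ hF hF0.1 hFnn
  rw [← hC₁, ← hκ] at herr
  set H := fderiv ℝ (gradient F) 0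
  have hX : 0 ≤ κ * δ * δ ^ 2 := by positivity
  set η : ℝ := 3 * (κ * δ) with hη
  have hηp : 0 < η := by positivity
  have hlow : ∀ v, -η * ‖v‖ ^ 2 ≤ inner ℝ (H v) v := fun v =>
    le_form_of_sphere H hδ0 v fun t htn => by
      have e1 := (abs_le.1 (herr _ htn)).1
      have e2 := hFnn (t • v) (by rw [mem_ball_zero_iff, htn]; linarith)
      rw [hη]
      linarith
  refine ⟨hgrad, ContinuousLinearMap.opNorm_le_bound _ hε.le fun x => ?_, fun y =>
    le_form_of_sphere H hδ0 (inrE d m y) ?_ |>.trans' (by rw [norm_inrE_apply])⟩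
  · have hup : inner ℝ (H (inlE d m x)) (inlE d m x) ≤ η * ‖inlE d m x‖ ^ 2 := by
      have := le_form_of_sphere (-H) (a := -η) hδ0 (inlE d m x) fun t htn => by
        have e1 := (abs_le.1 (herr _ htn)).2
        have e2 := (hineq (t • x) 0 (by
          rw [pt_eq, map_zero, add_zero, map_smul, mem_ball_zero_iff, htn]; linarith)).2
        rw [pt_eq, map_zero, add_zero, map_smul, norm_zero, ← hC₁] at e2
        have e4 : C * ρ ^ 2 ≤ κ / 2 * (δ * δ ^ 2) := by
          have : C ≤ κ / 2 := by rw [hκ]; linarith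
          gcongr
          calc ρ ^ 2 ≤ (δ ^ 2) ^ 2 := by gcongr
            _ = δ * (δ * δ ^ 2) := by ring
            _ ≤ 1 * (δ * δ ^ 2) := by gcongr; linarith
            _ = _ := one_mul _
        rw [neg_apply, inner_neg_left, hη]
        linarith
      rw [neg_apply, inner_neg_left] at this
      linarith
    have e1 := norm_sq_apply_le_of_form_le hsymm hHb hηp hlow hup
    rw [norm_inlE_apply] at e1
    have hη1 : η ≤ 1 := hδη.trans ((min_le_left _ _).trans (min_le_left _ _))
    have hηε : η ≤ ε / 2 := hδη.trans ((min_le_left _ _).trans (min_le_right _ _))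
    have e2 : 2 * η * (M + η) ≤ (ε / 2) ^ 2 := by
      have : η ≤ ε ^ 2 / (8 * (M + 1)) := hδη.trans (min_le_right _ _)
      rw [le_div_iff₀ (by positivity)] at this
      nlinarith
    have e3 : ‖H (inlE d m x) + η • inlE d m x‖ ≤ ε / 2 * ‖x‖ := by
      refine (sq_le_sq₀ (norm_nonneg _) (by positivity)).1 (e1.trans ?_)
      rw [mul_pow]
      gcongr
    have e4 : ‖η • inlE d m x‖ ≤ ε / 2 * ‖x‖ := by
      rw [norm_smul, Real.norm_of_nonneg hηp.le, norm_inlE_apply]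
      gcongr
    calc ‖H (inlE d m x)‖ = ‖(H (inlE d m x) + η • inlE d m x) - η • inlE d m x‖ := by
          rw [add_sub_cancel_right]
      _ ≤ _ := norm_sub_le _ _
      _ ≤ ε * ‖x‖ := by linarith
  · intro t htn
    have e1 := (abs_le.1 (herr _ htn)).1
    have e2 := (hineq 0 (t • y) (by
      rw [pt_eq, map_zero, zero_add, map_smul, mem_ball_zero_iff, htn]; linarith)).1
    rw [pt_eq, map_zero, zero_add, map_smul, ← norm_inrE_apply (d := d) (t • y), map_smul, htn]
      at e2
    have e3 := mul_le_mul_of_nonneg_right hδc (sq_nonneg δ)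
    have e4 := mul_pos hc₁ hρ2
    linarith

/-! ### Graphs of linear maps as top eigenspaces -/

/-- An invariant subspace on which all eigenvalues exceed `s`, while those on its orthogonal
complement do not, is spanned by the eigenvectors for the largest eigenvalues. -/
theorem topEigenspan_eq {V : Type*} [NormedAddCommGroup V] [InnerProductSpace ℝ V]
    [FiniteDimensional ℝ V] {A : Module.End ℝ V} (hA : LinearMap.IsSymmetric A)
    {Γ : Submodule ℝ V} {s : ℝ}
    (hinv : ∀ v ∈ Γ, A v ∈ Γ) (hhi : ∀ v ∈ Γ, v ≠ 0 → ∀ μ : ℝ, A v = μ • v → s < μ)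
    (hlo : ∀ v ∈ Γᗮ, v ≠ 0 → ∀ μ : ℝ, A v = μ • v → μ ≤ s) :
    topEigenspan A (Module.finrank ℝ Γ) = Γ := by
  have hinv' : ∀ v ∈ Γᗮ, A v ∈ Γᗮ := by
    intro v hv u hu
    rw [← hA u v]
    exact hv _ (hinv u hu)
  have hcases : ∀ μ : ℝ, (s < μ → A.eigenspace μ ≤ Γ) ∧ (μ ≤ s → A.eigenspace μ ≤ Γᗮ) := by
    intro μ
    have key : ∀ v ∈ A.eigenspace μ, ∃ v₁ ∈ Γ, ∃ v₂ ∈ Γᗮ, v = v₁ + v₂ ∧ A v₁ = μ • v₁ ∧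
        A v₂ = μ • v₂ := by
      intro v hv
      obtain ⟨v₁, h₁, v₂, h₂, rfl⟩ := Γ.exists_add_mem_mem_orthogonal v
      refine ⟨v₁, h₁, v₂, h₂, rfl, ?_⟩
      have e := Module.End.mem_eigenspace_iff.1 hv
      rw [map_add, smul_add] at e
      have e1 : A v₁ - μ • v₁ = -(A v₂ - μ • v₂) := by
        rw [← sub_eq_zero] at e ⊢
        rw [← e]; abel
      have m1 : A v₁ - μ • v₁ ∈ Γ := Γ.sub_mem (hinv _ h₁) (Γ.smul_mem _ h₁)
      have m2 : A v₁ - μ • v₁ ∈ Γᗮ := by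
        rw [e1]; exact Γᗮ.neg_mem (Γᗮ.sub_mem (hinv' _ h₂) (Γᗮ.smul_mem _ h₂))
      have z1 : A v₁ - μ • v₁ = 0 := inner_self_eq_zero.1 (m2 _ m1)
      refine ⟨sub_eq_zero.1 z1, sub_eq_zero.1 ?_⟩
      rw [z1] at e1
      exact neg_eq_zero.1 e1.symm
    refine ⟨fun hμ v hv => ?_, fun hμ v hv => ?_⟩
    · obtain ⟨v₁, h₁, v₂, h₂, rfl, a1, a2⟩ := key v hv
      have : v₂ = 0 := by
        by_contra hne
        exact absurd (hlo v₂ h₂ hne μ a2) (not_le.2 hμ)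
      rwa [this, add_zero]
    · obtain ⟨v₁, h₁, v₂, h₂, rfl, a1, a2⟩ := key v hv
      have : v₁ = 0 := by
        by_contra hne
        exact absurd (hhi v₁ h₁ hne μ a1) (not_lt.2 hμ)
      rwa [this, zero_add]
  have htop : ⨆ μ : ℝ, A.eigenspace μ = ⊤ := by
    rw [← Submodule.orthogonal_eq_bot_iff]
    exact hA.orthogonalComplement_iSup_eigenspaces_eq_bot
  have hS : Γ ≤ ⨆ (μ : ℝ) (_ : s < μ), A.eigenspace μ := by
    intro v hv
    have h1 : (⊤ : Submodule ℝ V) ≤ (⨆ (μ : ℝ) (_ : s < μ), A.eigenspace μ) ⊔ Γᗮ := by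
      rw [← htop]
      refine iSup_le fun μ => ?_
      rcases lt_or_ge s μ with h | h
      · exact le_sup_of_le_left (le_iSup₂_of_le μ h le_rfl)
      · exact ((hcases μ).2 h).trans le_sup_right
    obtain ⟨a, ha, b, hb, rfl⟩ := Submodule.mem_sup.1 (h1 (Submodule.mem_top (x := v)))
    have hS' : ⨆ (μ : ℝ) (_ : s < μ), A.eigenspace μ ≤ Γ :=
      iSup₂_le fun μ hμ => (hcases μ).1 hμ
    have ha' : a ∈ Γ := hS' ha
    have hb' : b ∈ Γ := by simpa using Γ.sub_mem hv ha'
    have : b = 0 := inner_self_eq_zero.1 (hb _ hb')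
    rwa [this, add_zero]
  -- an eigenvalue is among the top ones exactly if it exceeds `s`, by a count of dimensions
  refine le_antisymm (iSup₂_le fun μ hμ => ?_) (hS.trans (iSup₂_le fun μ hμ => ?_))
  · rcases lt_or_ge s μ with h | h
    · exact (hcases μ).1 h
    · refine absurd hμ (not_lt.2 (Submodule.finrank_mono (hS.trans ?_)))
      exact iSup₂_le fun ν hν => le_iSup₂_of_le ν (h.trans_lt hν) le_rfl
  · rcases eq_or_ne (A.eigenspace μ) ⊥ with h | h
    · rw [h]; exact bot_le
    obtain ⟨v, hv, hv0⟩ := Submodule.exists_mem_ne_zero_of_ne_bot h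
    refine le_iSup₂_of_le μ (Submodule.finrank_lt_finrank_of_lt (lt_of_le_of_ne
      (iSup₂_le fun ν hν => (hcases ν).1 (hμ.trans hν)) fun heq => hv0 ?_)) le_rfl
    have h2 : (⨆ (ν : ℝ) (_ : μ < ν), A.eigenspace ν) ≤ (Submodule.span ℝ {v})ᗮ := by
      refine iSup₂_le fun ν hν w hw => ?_
      rw [Submodule.mem_orthogonal_singleton_iff_inner_right]
      exact hA.orthogonalFamily_eigenspaces hν.ne ⟨v, hv⟩ ⟨w, hw⟩
    rw [heq] at h2
    exact inner_self_eq_zero.1 ((Submodule.mem_orthogonal_singleton_iff_inner_right).1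
      (h2 ((hcases μ).1 hμ hv)))

section Graph
variable {d m : ℕ}

/-- The embedding `y ↦ (L y, y)` onto the graph of `L`. -/
def graphMap (L : E (Fin m) →L[ℝ] E (Fin d)) : E (Fin m) →L[ℝ] E (Fin d ⊕ Fin m) :=
  (inlE d m).comp L + inrE d m

theorem graphMap_apply (L : E (Fin m) →L[ℝ] E (Fin d)) (y : E (Fin m)) :
    graphMap L y = inlE d m (L y) + inrE d m y := rfl

@[simp] theorem fstE_graphMap (L : E (Fin m) →L[ℝ] E (Fin d)) (y : E (Fin m)) :
    fstE d m (graphMap L y) = L y := by simp [graphMap_apply]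

@[simp] theorem sndE_graphMap (L : E (Fin m) →L[ℝ] E (Fin d)) (y : E (Fin m)) :
    sndE d m (graphMap L y) = y := by simp [graphMap_apply]

theorem mem_range_graphMap {L : E (Fin m) →L[ℝ] E (Fin d)} {v : E (Fin d ⊕ Fin m)} :
    v ∈ (graphMap L).range ↔ fstE d m v = L (sndE d m v) := by
  constructor
  · rintro ⟨y, rfl⟩; simp
  · intro h
    exact ⟨sndE d m v, by
      change graphMap L (sndE d m v) = v
      rw [graphMap_apply, ← h, inlE_fstE_add]⟩

theorem finrank_range_graphMap (L : E (Fin m) →L[ℝ] E (Fin d)) :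
    Module.finrank ℝ (graphMap L).range = m := by
  rw [LinearMap.finrank_range_of_inj, finrank_euclideanSpace_fin]
  intro y y' h
  simpa using congrArg (sndE d m) h

theorem inner_graphMap (L : E (Fin m) →L[ℝ] E (Fin d)) (y : E (Fin m)) (v : E (Fin d ⊕ Fin m)) :
    inner ℝ (graphMap L y) v =
      inner ℝ y (sndE d m v + ContinuousLinearMap.adjoint L (fstE d m v)) := by
  rw [graphMap_apply, inner_add_left, inner_inlE_left, inner_inrE_left, inner_add_right,
    ContinuousLinearMap.adjoint_inner_right, add_comm]

theorem mem_orthogonal_range_graphMap {L : E (Fin m) →L[ℝ] E (Fin d)} {v : E (Fin d ⊕ Fin m)} :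
    v ∈ (graphMap L).rangeᗮ ↔
      sndE d m v + ContinuousLinearMap.adjoint L (fstE d m v) = 0 := by
  constructor
  · intro h
    refine inner_self_eq_zero (𝕜 := ℝ).1 ?_
    rw [← inner_graphMap]
    exact h _ ⟨_, rfl⟩
  · rintro h _ ⟨y, rfl⟩
    change inner ℝ (graphMap L y) v = 0
    rw [inner_graphMap, h, inner_zero_right]

/-- The Riccati equation for `L`: it says that the graph of `L` is invariant under `H`. -/
def Riccati (H : E (Fin d ⊕ Fin m) →L[ℝ] E (Fin d ⊕ Fin m)) (L : E (Fin m) →L[ℝ] E (Fin d)) :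
    Prop :=
  ∀ y, fstE d m (H (graphMap L y)) = L (sndE d m (H (graphMap L y)))

/-- The off-diagonal blocks of a symmetric operator are adjoint to each other, so that a bound for
one is a bound for the other. -/
theorem norm_fstE_comp_inrE_le {H : E (Fin d ⊕ Fin m) →L[ℝ] E (Fin d ⊕ Fin m)}
    (hH : ∀ u v, inner ℝ (H u) v = inner ℝ u (H v)) {τ : ℝ} (hτ : ‖H.comp (inlE d m)‖ ≤ τ) :
    ‖((fstE d m).comp H).comp (inrE d m)‖ ≤ τ := by
  have hτ0 : 0 ≤ τ := (norm_nonneg _).trans hτ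
  refine ContinuousLinearMap.opNorm_le_bound _ hτ0 fun y => ?_
  set x := fstE d m (H (inrE d m y)) with hx
  change ‖x‖ ≤ τ * ‖y‖
  have h1 : ‖x‖ * ‖x‖ ≤ τ * ‖y‖ * ‖x‖ := by
    calc ‖x‖ * ‖x‖ = inner ℝ x x := by rw [real_inner_self_eq_norm_mul_norm]
      _ = inner ℝ (H (inlE d m x)) (inrE d m y) := by
        conv_lhs => rw [hx, ← inner_inlE_left, ← hH]
      _ ≤ ‖H (inlE d m x)‖ * ‖inrE d m y‖ := real_inner_le_norm _ _
      _ ≤ (τ * ‖x‖) * ‖y‖ := by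
        rw [norm_inrE_apply]
        gcongr
        exact ContinuousLinearMap.le_of_opNorm_le _ hτ x
      _ = _ := by ring
  rcases (norm_nonneg x).eq_or_lt with h0 | h0
  · rw [← h0]; positivity
  · exact le_of_mul_le_mul_right h1 h0

/-- The graph of a small solution of the Riccati equation is the span of the top eigenvectors. -/
theorem topEigenspan_eq_range_graphMap {H : E (Fin d ⊕ Fin m) →L[ℝ] E (Fin d ⊕ Fin m)}
    (hH : ∀ u v, inner ℝ (H u) v = inner ℝ u (H v)) {τ c₁ : ℝ} (hc₁ : 0 < c₁)
    (hτ : ‖H.comp (inlE d m)‖ ≤ τ) (hτc : τ ≤ c₁ / 8)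
    (hco : ∀ y, 3 / 4 * c₁ * ‖y‖ ^ 2 ≤ inner ℝ (H (inrE d m y)) (inrE d m y))
    {L : E (Fin m) →L[ℝ] E (Fin d)} (hL : ‖L‖ ≤ 1) (hR : Riccati H L) :
    topEigenspan (H : E (Fin d ⊕ Fin m) →ₗ[ℝ] E (Fin d ⊕ Fin m)) m = (graphMap L).range := by
  have hτ0 : 0 ≤ τ := (norm_nonneg _).trans hτ
  have hHl : ∀ x, ‖H (inlE d m x)‖ ≤ τ * ‖x‖ := ContinuousLinearMap.le_of_opNorm_le _ hτ
  have hB : ∀ y, ‖fstE d m (H (inrE d m y))‖ ≤ τ * ‖y‖ :=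
    ContinuousLinearMap.le_of_opNorm_le _ (norm_fstE_comp_inrE_le hH hτ)
  have hL' : ∀ y, ‖L y‖ ≤ ‖y‖ := fun y => by
    simpa using ContinuousLinearMap.le_of_opNorm_le _ hL y
  have := topEigenspan_eq (A := (H : E (Fin d ⊕ Fin m) →ₗ[ℝ] E (Fin d ⊕ Fin m)))
    (Γ := (graphMap L).range) (s := c₁ / 2) hH ?_ ?_ ?_
  · rwa [finrank_range_graphMap] at this
  · rintro _ ⟨y, rfl⟩
    exact mem_range_graphMap.2 (hR y)
  · rintro _ ⟨y, rfl⟩ hne μ hμ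
    change H (graphMap L y) = μ • graphMap L y at hμ
    have hy : y ≠ 0 := by
      rintro rfl
      exact hne (map_zero (graphMap L))
    have hy' : 0 < ‖y‖ ^ 2 := by positivity
    have e1 : inner ℝ (H (graphMap L y)) (inrE d m y) = μ * ‖y‖ ^ 2 := by
      rw [hμ, real_inner_smul_left, real_inner_comm, inner_inrE_left, sndE_graphMap,
        real_inner_self_eq_norm_sq]
    rw [graphMap_apply, map_add, inner_add_left] at e1
    have e2 : |inner ℝ (H (inlE d m (L y))) (inrE d m y)| ≤ τ * ‖y‖ ^ 2 := by
      refine (abs_real_inner_le_norm _ _).trans ?_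
      rw [norm_inrE_apply, sq, ← mul_assoc]
      gcongr
      exact (hHl _).trans (by gcongr; exact hL' y)
    have e3 := hco y
    have e4 := (abs_le.1 e2).1
    have e5 : τ * ‖y‖ ^ 2 ≤ c₁ / 8 * ‖y‖ ^ 2 := by gcongr
    have e6 : (c₁ * 5 / 8) * ‖y‖ ^ 2 ≤ μ * ‖y‖ ^ 2 := by linarith
    have := le_of_mul_le_mul_right e6 hy'
    linarith
  · intro v hv hne μ hμ
    rw [mem_orthogonal_range_graphMap] at hv
    set x := fstE d m v with hx
    have hw : sndE d m v = -ContinuousLinearMap.adjoint L x := eq_neg_of_add_eq_zero_left hv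
    have hw' : ‖sndE d m v‖ ≤ ‖x‖ := by
      rw [hw, norm_neg]
      have : ‖ContinuousLinearMap.adjoint L‖ ≤ 1 := by
        rwa [LinearIsometryEquiv.norm_map]
      simpa using ContinuousLinearMap.le_of_opNorm_le _ this x
    have hx0 : 0 < ‖x‖ := by
      rw [norm_pos_iff]
      intro h0
      rw [h0, map_zero, neg_zero] at hw
      apply hne
      rw [← inlE_fstE_add v, ← hx, h0, hw, map_zero, map_zero, add_zero]
    change H v = μ • v at hμ
    have e1 : μ • x = fstE d m (H (inlE d m x)) + fstE d m (H (inrE d m (sndE d m v))) := by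
      rw [← map_add, ← map_add, hx, inlE_fstE_add, hμ, map_smul]
    have e2 : |μ| * ‖x‖ ≤ 2 * τ * ‖x‖ := by
      rw [← Real.norm_eq_abs, ← norm_smul, e1]
      refine (norm_add_le _ _).trans ?_
      have e3 := (norm_fstE_apply_le (H (inlE d m x))).trans (hHl x)
      have e4 := (hB (sndE d m v)).trans (mul_le_mul_of_nonneg_left hw' hτ0)
      linarith
    have e3 := le_of_mul_le_mul_right e2 hx0
    have e4 := le_abs_self μ
    linarith

/-- The orthogonal projection onto the graph of `L` is `J (J* J)⁻¹ J*` with `J y = (L y, y)`. The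
inverse of `J* J = 1 + L* L` is written as `1 + S`. -/
theorem starProjection_range_graphMap {L : E (Fin m) →L[ℝ] E (Fin d)}
    {S : E (Fin m) →L[ℝ] E (Fin m)}
    (hS : S + ((ContinuousLinearMap.adjoint L).comp L).comp S +
      (ContinuousLinearMap.adjoint L).comp L = 0) :
    (graphMap L).range.starProjection =
      ((graphMap L).comp (1 + S)).comp
        (sndE d m + (ContinuousLinearMap.adjoint L).comp (fstE d m)) := by
  ext1 v
  refine (Submodule.eq_starProjection_of_mem_orthogonal ⟨_, rfl⟩ ?_)
  rw [mem_orthogonal_range_graphMap]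
  set u := sndE d m v + ContinuousLinearMap.adjoint L (fstE d m v) with hu
  clear_value u
  have h1 : (((graphMap L).comp (1 + S)).comp (sndE d m +
      (ContinuousLinearMap.adjoint L).comp (fstE d m))) v = graphMap L (u + S u) := by
    rw [hu]; rfl
  rw [h1, map_sub, map_sub, sndE_graphMap, fstE_graphMap, map_sub]
  have h2 := congrArg (fun φ : E (Fin m) →L[ℝ] E (Fin m) => φ u) hS
  simp only [add_apply, ContinuousLinearMap.comp_apply, zero_apply] at h2
  rw [map_add, map_add]
  calc _ = (sndE d m v + ContinuousLinearMap.adjoint L (fstE d m v)) - u -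
        (S u + ContinuousLinearMap.adjoint L (L (S u)) + ContinuousLinearMap.adjoint L (L u)) := by
        abel
    _ = 0 := by rw [← hu, h2]; simp

end Graph

/-! ### Solving the Riccati equation -/

/-- A coercive endomorphism of a finite-dimensional space has a bounded inverse. -/
theorem exists_inverse_of_coercive {Y : Type*} [NormedAddCommGroup Y] [InnerProductSpace ℝ Y]
    [FiniteDimensional ℝ Y] (D : Y →L[ℝ] Y) {c : ℝ} (hc : 0 < c)
    (h : ∀ y, c * ‖y‖ ^ 2 ≤ inner ℝ (D y) y) :
    ∃ R : Y →L[ℝ] Y, D.comp R = ContinuousLinearMap.id ℝ Y ∧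
      R.comp D = ContinuousLinearMap.id ℝ Y ∧ ‖R‖ ≤ c⁻¹ := by
  have hlow : ∀ y, c * ‖y‖ ≤ ‖D y‖ := by
    intro y
    rcases (norm_nonneg y).eq_or_lt with h0 | h0
    · rw [← h0, mul_zero]; exact norm_nonneg _
    · have := (h y).trans (real_inner_le_norm _ _)
      rw [sq, ← mul_assoc] at this
      exact le_of_mul_le_mul_right this h0
  have hinj : Function.Injective (D : Y →ₗ[ℝ] Y) := by
    refine (injective_iff_map_eq_zero _).2 fun y hy => ?_
    have h1 := hlow y
    rw [show D y = 0 from hy, norm_zero] at h1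
    exact norm_eq_zero.1 (le_antisymm (by nlinarith [norm_nonneg y]) (norm_nonneg _))
  set e := LinearEquiv.ofInjectiveEndo (D : Y →ₗ[ℝ] Y) hinj with he
  have he' : ∀ y, e y = D y := fun y => rfl
  refine ⟨LinearMap.toContinuousLinearMap (e.symm : Y →ₗ[ℝ] Y), ?_, ?_, ?_⟩
  · ext1 y
    exact (he' _).symm.trans (e.apply_symm_apply y)
  · ext1 y
    exact e.symm_apply_apply y
  · refine ContinuousLinearMap.opNorm_le_bound _ (by positivity) fun y => ?_
    have h1 := hlow (e.symm y)
    rw [← he', e.apply_symm_apply] at h1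
    rw [inv_mul_eq_div, le_div_iff₀ hc, mul_comm]
    exact h1

/-- The Riccati equation has a small solution near a point where the Hessian is nearly
block-diagonal, and it depends on the point with bounds on its derivatives. -/
theorem exists_slope {j : ℕ} (hj : 1 ≤ j) (M : ℝ) {c₁ : ℝ} (hc₁ : 0 < c₁) :
    ∃ K, ∀ {d m : ℕ} {U : Set (E (Fin d ⊕ Fin m))}
      {H : E (Fin d ⊕ Fin m) → E (Fin d ⊕ Fin m) →L[ℝ] E (Fin d ⊕ Fin m)}
      {D₀ R : E (Fin m) →L[ℝ] E (Fin m)} {τ : ℝ},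
      IsOpen U → (∀ z ∈ U, ‖z‖ ≤ 1) → BddCk j M H U →
      (∀ z ∈ U, ∀ u v, inner ℝ (H z u) v = inner ℝ u (H z v)) →
      D₀.comp R = ContinuousLinearMap.id ℝ _ → R.comp D₀ = ContinuousLinearMap.id ℝ _ →
      ‖R‖ ≤ c₁⁻¹ → τ ≤ c₁ / 8 → (∀ z ∈ U, ‖(H z).comp (inlE d m)‖ ≤ τ) →
      (∀ z ∈ U, ‖D₀ - ((sndE d m).comp (H z)).comp (inrE d m)‖ ≤ τ) →
      ∃ L : E (Fin d ⊕ Fin m) → E (Fin m) →L[ℝ] E (Fin d), BddCk j K L U ∧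
        ∀ z ∈ U, ‖L z‖ ≤ 2 * τ / c₁ ∧ Riccati (H z) (L z) := by
  obtain ⟨K, hK⟩ := BddCk.exists_implicit hj
    (c₁⁻¹ * (2 ^ j * (1 * (2 ^ j * (j.factorial * M * 1 ^ j * (1 + 1)))) +
      2 ^ j * (j.factorial * M * 1 ^ j * (1 + 1))))
  refine ⟨K, fun {d m U H D₀ R τ} hU hU1 hH hsymm hDR hRD hR hτ hHl hHD => ?_⟩
  let T : E (Fin d ⊕ Fin m) → (E (Fin m) →L[ℝ] E (Fin d)) → (E (Fin m) →L[ℝ] E (Fin d)) :=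
    fun z L =>
    L.comp ((sndE d m).comp ((H z).comp (graphMap L))) - (fstE d m).comp ((H z).comp (graphMap L))
  let G : E (Fin d ⊕ Fin m) × (E (Fin m) →L[ℝ] E (Fin d)) → (E (Fin m) →L[ℝ] E (Fin d)) :=
    fun q => (T q.1 q.2).comp R
  have hV : IsOpen (U ×ˢ ball (0 : E (Fin m) →L[ℝ] E (Fin d)) 1) := hU.prod isOpen_ball
  have hV1 : ∀ q ∈ U ×ˢ ball (0 : E (Fin m) →L[ℝ] E (Fin d)) 1, ‖q‖ ≤ 1 := fun q hq =>
    max_le (hU1 _ hq.1) (mem_ball_zero_iff.1 hq.2).le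
  have hfst : BddCk j 1 (fun q : E (Fin d ⊕ Fin m) × (E (Fin m) →L[ℝ] E (Fin d)) => q.1)
      (U ×ˢ ball (0 : E (Fin m) →L[ℝ] E (Fin d)) 1) :=
    BddCk.fst hV le_rfl hV1
  have hsnd : BddCk j 1 (fun q : E (Fin d ⊕ Fin m) × (E (Fin m) →L[ℝ] E (Fin d)) => q.2)
      (U ×ˢ ball (0 : E (Fin m) →L[ℝ] E (Fin d)) 1) :=
    BddCk.snd hV le_rfl hV1
  have hH' := hH.comp hfst hV hU (fun q hq => hq.1) le_rfl
  have hJ : BddCk j (1 + 1)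
      (fun q : E (Fin d ⊕ Fin m) × (E (Fin m) →L[ℝ] E (Fin d)) => graphMap q.2)
      (U ×ˢ ball (0 : E (Fin m) →L[ℝ] E (Fin d)) 1) :=
    (hsnd.clm_comp_one hV _ (norm_postcomp_le norm_inlE_le)).add
      (BddCk.const (inrE d m) norm_inrE_le) hV
  have hW := hH'.clm_mul hJ hV
  have hG : BddCk j (c₁⁻¹ * (2 ^ j * (1 * (2 ^ j * (j.factorial * M * 1 ^ j * (1 + 1)))) +
      2 ^ j * (j.factorial * M * 1 ^ j * (1 + 1)))) G
      (U ×ˢ ball (0 : E (Fin m) →L[ℝ] E (Fin d)) 1) :=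
    ((hsnd.clm_mul (hW.clm_comp_one hV _ (norm_postcomp_le norm_sndE_le)) hV).sub
      (hW.clm_comp_one hV _ (norm_postcomp_le norm_fstE_le)) hV).clm_comp hV _ (norm_precomp_le hR)
  have hlip : ∀ z ∈ U, ∀ L ∈ ball (0 : E (Fin m) →L[ℝ] E (Fin d)) 1,
      ∀ L' ∈ ball (0 : E (Fin m) →L[ℝ] E (Fin d)) 1,
      ‖(L - G (z, L)) - (L' - G (z, L'))‖ ≤ 1 / 2 * ‖L - L'‖ := by
    intro z hz L hL L' hL'
    have hL1 : ‖L‖ ≤ 1 := (mem_ball_zero_iff.1 hL).le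
    have hL1' : ‖L'‖ ≤ 1 := (mem_ball_zero_iff.1 hL').le
    have hτ0 : 0 ≤ τ := (norm_nonneg _).trans (hHl z hz)
    set D := L - L' with hD
    have e1 : (L - G (z, L)) - (L' - G (z, L')) =
        (D.comp (D₀ - ((sndE d m).comp (H z)).comp (inrE d m))
          - D.comp ((sndE d m).comp (((H z).comp (inlE d m)).comp L))
          - L'.comp ((sndE d m).comp (((H z).comp (inlE d m)).comp D))
          + (fstE d m).comp (((H z).comp (inlE d m)).comp D)).comp R := by
      ext1 y
      have hy : D₀ (R y) = y := congrArg (fun φ : E (Fin m) →L[ℝ] E (Fin m) => φ y) hDR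
      simp only [G, T, hD, graphMap_apply, sub_apply, add_apply, ContinuousLinearMap.comp_apply,
        map_sub, map_add, hy]
      abel
    have b1 : ‖D.comp (D₀ - ((sndE d m).comp (H z)).comp (inrE d m))‖ ≤ ‖D‖ * τ :=
      norm_comp_le_mul le_rfl (hHD z hz)
    have b2 : ‖D.comp ((sndE d m).comp (((H z).comp (inlE d m)).comp L))‖ ≤
        ‖D‖ * (1 * (τ * 1)) := norm_comp_le_mul le_rfl
      (norm_comp_le_mul norm_sndE_le (norm_comp_le_mul (hHl z hz) hL1))
    have b3 : ‖L'.comp ((sndE d m).comp (((H z).comp (inlE d m)).comp D))‖ ≤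
        1 * (1 * (τ * ‖D‖)) := norm_comp_le_mul hL1'
      (norm_comp_le_mul norm_sndE_le (norm_comp_le_mul (hHl z hz) le_rfl))
    have b4 : ‖(fstE d m).comp (((H z).comp (inlE d m)).comp D)‖ ≤ 1 * (τ * ‖D‖) :=
      norm_comp_le_mul norm_fstE_le (norm_comp_le_mul (hHl z hz) le_rfl)
    rw [e1]
    have b5 := norm_comp_le_mul ((norm_add_le _ _).trans (add_le_add ((norm_sub_le _ _).trans
      (add_le_add ((norm_sub_le _ _).trans (add_le_add b1 b2)) b3)) b4)) hR
    refine b5.trans ?_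
    calc _ = 4 * τ * c₁⁻¹ * ‖D‖ := by ring
      _ ≤ 1 / 2 * ‖D‖ := by
        gcongr
        rw [mul_inv_le_iff₀ hc₁]
        linarith
  have h0 : ∀ z ∈ U, ‖G (z, 0)‖ ≤ τ * c₁⁻¹ := by
    intro z hz
    refine norm_comp_le_mul ?_ hR
    have : T z 0 = -((fstE d m).comp (H z)).comp (inrE d m) := by
      ext1 y
      simp [T, graphMap_apply]
    rw [this, norm_neg]
    exact norm_fstE_comp_inrE_le (hsymm z hz) (hHl z hz)
  obtain ⟨L, hL, -, hLb⟩ := hK (b := 1) hU one_pos le_rfl hU1 hG hlip (fun z hz => by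
    refine (h0 z hz).trans_lt ?_
    rw [← div_eq_mul_inv, div_lt_iff₀ hc₁]
    linarith)
  refine ⟨L, hLb, fun z hz => ⟨?_, fun y => ?_⟩⟩
  · refine (hL z hz).2.2.trans ?_
    rw [mul_div_assoc, div_eq_mul_inv]
    gcongr
    exact h0 z hz
  · have e1 : T z (L z) (R (D₀ y)) = 0 :=
      congrArg (fun φ : E (Fin m) →L[ℝ] E (Fin d) => φ (D₀ y)) (hL z hz).2.1
    rw [show R (D₀ y) = y from congrArg (fun φ : E (Fin m) →L[ℝ] E (Fin m) => φ y) hRD] at e1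
    exact (sub_eq_zero.1 e1).symm

/-- The operator `S = (1 + L* L)⁻¹ - 1`, which enters the projection onto the graph of `L`. -/
theorem exists_gram_inverse {j : ℕ} (hj : 1 ≤ j) (K : ℝ) :
    ∃ K', ∀ {A X Y : Type} [NormedAddCommGroup A] [NormedSpace ℝ A] [CompleteSpace A]
      [NormedAddCommGroup X] [InnerProductSpace ℝ X] [CompleteSpace X]
      [NormedAddCommGroup Y] [InnerProductSpace ℝ Y] [CompleteSpace Y]
      {U : Set A} {L : A → Y →L[ℝ] X},
      IsOpen U → (∀ z ∈ U, ‖z‖ ≤ 1) → BddCk j K L U → (∀ z ∈ U, ‖L z‖ ≤ 1 / 2) →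
      ∃ S : A → Y →L[ℝ] Y, BddCk j K' S U ∧
        ∀ z ∈ U, S z + ((ContinuousLinearMap.adjoint (L z)).comp (L z)).comp (S z) +
          (ContinuousLinearMap.adjoint (L z)).comp (L z) = 0 := by
  obtain ⟨K', hK'⟩ := BddCk.exists_implicit hj
    ((1 + 2 ^ j * ((j.factorial * (2 ^ j * (K * K)) * 1 ^ j) * 1)) +
      j.factorial * (2 ^ j * (K * K)) * 1 ^ j)
  refine ⟨K', fun {A X Y} _ _ _ _ _ _ _ _ _ {U L} hU hU1 hL hLs => ?_⟩
  let P : A → Y →L[ℝ] Y := fun z => (adjointL Y X (L z)).comp (L z)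
  let G : A × (Y →L[ℝ] Y) → (Y →L[ℝ] Y) := fun q =>
    q.2 + (P q.1).comp q.2 + P q.1
  have hV : IsOpen (U ×ˢ ball (0 : Y →L[ℝ] Y) 1) := hU.prod isOpen_ball
  have hV1 : ∀ q ∈ U ×ˢ ball (0 : Y →L[ℝ] Y) 1, ‖q‖ ≤ 1 := fun q hq =>
    max_le (hU1 _ hq.1) (mem_ball_zero_iff.1 hq.2).le
  have hfst : BddCk j 1 (fun q : A × (Y →L[ℝ] Y) => q.1)
      (U ×ˢ ball (0 : Y →L[ℝ] Y) 1) :=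
    BddCk.fst hV le_rfl hV1
  have hsnd : BddCk j 1 (fun q : A × (Y →L[ℝ] Y) => q.2)
      (U ×ˢ ball (0 : Y →L[ℝ] Y) 1) :=
    BddCk.snd hV le_rfl hV1
  have hP : BddCk j (2 ^ j * (K * K)) P U :=
    (hL.clm_comp_one hU _ norm_adjointL_le).clm_mul hL hU
  have hP' := hP.comp hfst hV hU (fun q hq => hq.1) le_rfl
  have hG := (hsnd.add (hP'.clm_mul hsnd hV) hV).add hP' hV
  have hPs : ∀ z ∈ U, ‖P z‖ ≤ 1 / 2 * (1 / 2) := fun z hz =>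
    norm_comp_le_mul (by
      rw [adjointL_apply, LinearIsometryEquiv.norm_map]
      exact hLs z hz) (hLs z hz)
  obtain ⟨S, hS, -, hSb⟩ := hK' (b := 1) (G := G) hU one_pos le_rfl hU1 hG
    (fun z hz S _ S' _ => by
      have e1 : (S - G (z, S)) - (S' - G (z, S')) = -(P z).comp (S - S') := by
        simp only [G, ContinuousLinearMap.comp_sub]
        abel
      rw [e1, norm_neg]
      refine (norm_comp_le_mul (hPs z hz) le_rfl).trans ?_
      gcongr
      norm_num)
    (fun z hz => by
      have e1 : G (z, 0) = P z := by simp [G]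
      rw [e1]
      exact (hPs z hz).trans_lt (by norm_num))
  exact ⟨S, hSb, fun z hz => (hS z hz).2.1⟩

/-- The projection onto the graph of `L` inherits the bounds on the derivatives of `L`. -/
theorem exists_bddCk_projection {j : ℕ} (hj : 1 ≤ j) (K : ℝ) :
    ∃ K', ∀ {d m : ℕ} {U : Set (E (Fin d ⊕ Fin m))}
      {L : E (Fin d ⊕ Fin m) → E (Fin m) →L[ℝ] E (Fin d)},
      IsOpen U → (∀ z ∈ U, ‖z‖ ≤ 1) → BddCk j K L U → (∀ z ∈ U, ‖L z‖ ≤ 1 / 2) →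
      BddCk j K' (fun z => (graphMap (L z)).range.starProjection) U := by
  obtain ⟨K₁, hK₁⟩ := exists_gram_inverse hj K
  refine ⟨2 ^ j * ((2 ^ j * ((K + 1) * (1 + K₁))) * (1 + K)),
    fun {d m U L} hU hU1 hL hLs => ?_⟩
  obtain ⟨S, hSb, hS⟩ := hK₁ hU hU1 hL hLs
  have hJ : BddCk j (K + 1) (fun z => graphMap (L z)) U :=
    (hL.clm_comp_one hU _ (norm_postcomp_le norm_inlE_le)).add
      (BddCk.const (inrE d m) norm_inrE_le) hU
  have hS' : BddCk j (1 + K₁) (fun z => 1 + S z) U :=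
    (BddCk.const 1 ContinuousLinearMap.norm_id_le).add hSb hU
  have hA : BddCk j (1 + K)
      (fun z => sndE d m + (ContinuousLinearMap.adjoint (L z)).comp (fstE d m)) U :=
    (BddCk.const (sndE d m) norm_sndE_le).add
      ((hL.clm_comp_one hU _ norm_adjointL_le).clm_comp_one hU _
        (norm_precomp_le norm_fstE_le)) hU
  exact ((hJ.clm_mul hS' hU).clm_mul hA hU).congr hU fun z hz =>
    starProjection_range_graphMap (hS z hz)

/-! ### The critical graph and the coordinates along it -/

/-- The component along the graph of `L` of a vector `v`, read in the coordinate `y`: it vanishes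
exactly if `v` is orthogonal to the graph. -/
def graphComponent {d m : ℕ} (L : E (Fin m) →L[ℝ] E (Fin d)) (v : E (Fin d ⊕ Fin m)) : E (Fin m) :=
  sndE d m v + ContinuousLinearMap.adjoint L (fstE d m v)

theorem norm_graphComponent_le {d m : ℕ} {L : E (Fin m) →L[ℝ] E (Fin d)} {lam : ℝ}
    (hL : ‖L‖ ≤ lam) (v : E (Fin d ⊕ Fin m)) : ‖graphComponent L v‖ ≤ (1 + lam) * ‖v‖ := by
  have h1 : ‖ContinuousLinearMap.adjoint L‖ ≤ lam := by rwa [LinearIsometryEquiv.norm_map]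
  refine (norm_add_le _ _).trans ?_
  rw [add_mul, one_mul]
  refine add_le_add (norm_sndE_apply_le v)
    ((ContinuousLinearMap.le_of_opNorm_le _ h1 _).trans ?_)
  exact mul_le_mul_of_nonneg_left (norm_fstE_apply_le v) ((norm_nonneg _).trans hL)

theorem bddCk_graphComponent {d m j : ℕ} {K M : ℝ} {U : Set (E (Fin d ⊕ Fin m))}
    {L : E (Fin d ⊕ Fin m) → E (Fin m) →L[ℝ] E (Fin d)}
    {p : E (Fin d ⊕ Fin m) → E (Fin d ⊕ Fin m)} (hU : IsOpen U) (hL : BddCk j K L U)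
    (hp : BddCk j M p U) :
    BddCk j (M + 2 ^ j * (K * M)) (fun z => graphComponent (L z) (p z)) U :=
  (hp.clm_comp_one hU (sndE d m) norm_sndE_le).add
    ((hL.clm_comp_one hU (adjointL _ _) norm_adjointL_le).clm_apply
      (hp.clm_comp_one hU (fstE d m) norm_fstE_le) hU) hU

theorem pt_sub_pt_right {d m : ℕ} (x : E (Fin d)) (y y' : E (Fin m)) :
    pt x y - pt x y' = inrE d m (y - y') := by
  rw [pt_eq, pt_eq, map_sub]; abel

theorem pt_mem_ball {d m : ℕ} {a b r : ℝ} (hr : 0 ≤ r) (hab : b ^ 2 + a ^ 2 ≤ r ^ 2)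
    {x : E (Fin d)} {y : E (Fin m)} (hx : x ∈ ball (0 : E (Fin d)) a)
    (hy : y ∈ ball (0 : E (Fin m)) b) : pt x y ∈ ball (0 : E (Fin d ⊕ Fin m)) r := by
  rw [mem_ball_zero_iff] at *
  have h1 : ‖x‖ ^ 2 < a ^ 2 := by gcongr
  have h2 : ‖y‖ ^ 2 < b ^ 2 := by gcongr
  have h3 := norm_pt_sq x y
  exact lt_of_pow_lt_pow_left₀ 2 hr (by linarith)

/-- The zeros of the component of `p` along the graph of `L` form a graph over the `x` variable, if
the derivative of `p` varies little and its `y` block is invertible, with inverse `R`, at the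
origin. -/
theorem exists_critical_graph {j : ℕ} (hj : 1 ≤ j) (M K c₁ : ℝ) :
    ∃ K', ∀ {d m : ℕ} {r a b lam σ σ₀ τ : ℝ} {p : E (Fin d ⊕ Fin m) → E (Fin d ⊕ Fin m)}
      {L : E (Fin d ⊕ Fin m) → E (Fin m) →L[ℝ] E (Fin d)} {R : E (Fin m) →L[ℝ] E (Fin m)},
      r ≤ 1 → 0 < r → 0 < a → 0 < b → b ^ 2 + a ^ 2 ≤ r ^ 2 →
      BddCk j M p (ball 0 r) → BddCk j K L (ball 0 r) → (∀ z ∈ ball 0 r, ‖L z‖ ≤ lam) →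
      R.comp (((sndE d m).comp (fderiv ℝ p 0)).comp (inrE d m)) = ContinuousLinearMap.id ℝ _ →
      ‖R‖ ≤ c₁⁻¹ → (∀ z ∈ ball 0 r, ‖fderiv ℝ p z - fderiv ℝ p 0‖ ≤ τ) →
      (∀ z ∈ ball 0 r, ‖p z‖ ≤ σ) → c₁⁻¹ * (τ + (K * σ + lam * M)) ≤ 1 / 2 →
      (∀ x ∈ ball 0 a, ‖p (pt x 0)‖ ≤ σ₀) → c₁⁻¹ * ((1 + lam) * σ₀) < b / 2 →
      ∃ Ψ : E (Fin d) → E (Fin m), BddCk j K' Ψ (ball 0 a) ∧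
        (∀ x ∈ ball 0 a, Ψ x ∈ ball 0 b ∧
          graphComponent (L (pt x (Ψ x))) (p (pt x (Ψ x))) = 0 ∧
          ‖Ψ x‖ ≤ 2 * (c₁⁻¹ * ((1 + lam) * ‖p (pt x 0)‖))) ∧
        ∀ x ∈ ball 0 a, ∀ y ∈ ball 0 b, graphComponent (L (pt x y)) (p (pt x y)) = 0 → y = Ψ x := by
  obtain ⟨K', hK'⟩ := BddCk.exists_implicit hj
    (c₁⁻¹ * (j.factorial * (M + 2 ^ j * (K * M)) * (1 + 1) ^ j))
  refine ⟨K', fun {d m r a b lam σ σ₀ τ p L R} hr1 hr0 ha hb hab hp hL hLs hR hRn hpd hps hsmall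
    hp0 hsmall0 => ?_⟩
  have hc : 0 ≤ c₁⁻¹ := (norm_nonneg _).trans hRn
  have hzero : (0 : E (Fin d ⊕ Fin m)) ∈ ball (0 : E (Fin d ⊕ Fin m)) r := mem_ball_self hr0
  have hlam : 0 ≤ lam := (norm_nonneg _).trans (hLs 0 hzero)
  have har : a ≤ 1 := by nlinarith
  have hbr : b ≤ 1 := by nlinarith
  let g : E (Fin d ⊕ Fin m) → E (Fin m) := fun z => graphComponent (L z) (p z)
  let G : E (Fin d) × E (Fin m) → E (Fin m) := fun q => R (g (inlE d m q.1 + inrE d m q.2))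
  have hU : IsOpen (ball (0 : E (Fin d)) a) := isOpen_ball
  have hV : IsOpen (ball (0 : E (Fin d)) a ×ˢ ball (0 : E (Fin m)) b) := hU.prod isOpen_ball
  have hU1 : ∀ x ∈ ball (0 : E (Fin d)) a, ‖x‖ ≤ 1 := fun x hx =>
    (mem_ball_zero_iff.1 hx).le.trans har
  have hV1 : ∀ q ∈ ball (0 : E (Fin d)) a ×ˢ ball (0 : E (Fin m)) b, ‖q‖ ≤ 1 := fun q hq =>
    max_le (hU1 _ hq.1) ((mem_ball_zero_iff.1 hq.2).le.trans hbr)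
  have hpt : BddCk j (1 + 1) (fun q : E (Fin d) × E (Fin m) => inlE d m q.1 + inrE d m q.2)
      (ball (0 : E (Fin d)) a ×ˢ ball (0 : E (Fin m)) b) :=
    ((BddCk.fst hV le_rfl hV1).clm_comp_one hV (inlE d m) norm_inlE_le).add
      ((BddCk.snd hV le_rfl hV1).clm_comp_one hV (inrE d m) norm_inrE_le) hV
  have hg : BddCk j (M + 2 ^ j * (K * M)) g (ball 0 r) := bddCk_graphComponent isOpen_ball hL hp
  have hG : BddCk j (c₁⁻¹ * (j.factorial * (M + 2 ^ j * (K * M)) * (1 + 1) ^ j)) G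
      (ball (0 : E (Fin d)) a ×ˢ ball (0 : E (Fin m)) b) :=
    (hg.comp hpt hV isOpen_ball (fun q hq => by
      rw [← pt_eq]
      exact pt_mem_ball hr0.le hab hq.1 hq.2) (by norm_num)).clm_comp hV R hRn
  have hGeq : ∀ x y, G (x, y) = R (graphComponent (L (pt x y)) (p (pt x y))) := fun x y => by
    simp only [G, g, pt_eq]
  have hRinj : ∀ w, R w = 0 → w = 0 := by
    have hsurj : Function.Surjective (R : E (Fin m) →ₗ[ℝ] E (Fin m)) := fun y =>
      ⟨_, congrArg (fun φ : E (Fin m) →L[ℝ] E (Fin m) => φ y) hR⟩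
    have hinj := LinearMap.injective_iff_surjective.2 hsurj
    intro w hw
    exact hinj (hw.trans (map_zero R).symm)
  have hlip : ∀ x ∈ ball (0 : E (Fin d)) a, ∀ y ∈ ball (0 : E (Fin m)) b,
      ∀ y' ∈ ball (0 : E (Fin m)) b,
      ‖(y - G (x, y)) - (y' - G (x, y'))‖ ≤ 1 / 2 * ‖y - y'‖ := by
    intro x hx y hy y' hy'
    have hz := pt_mem_ball hr0.le hab hx hy
    have hz' := pt_mem_ball hr0.le hab hx hy'
    have hzz : ‖pt x y - pt x y'‖ = ‖y - y'‖ := by rw [pt_sub_pt_right, norm_inrE_apply]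
    have hRid : R (sndE d m (fderiv ℝ p 0 (pt x y - pt x y'))) = y - y' := by
      rw [pt_sub_pt_right]
      exact congrArg (fun φ : E (Fin m) →L[ℝ] E (Fin m) => φ (y - y')) hR
    rw [hGeq, hGeq]
    set z := pt x y
    set z' := pt x y'
    have e1 : ‖p z - p z' - fderiv ℝ p 0 (z - z')‖ ≤ τ * ‖y - y'‖ := by
      rw [← hzz]
      exact (convex_ball (0 : E (Fin d ⊕ Fin m)) r).norm_image_sub_le_of_norm_fderiv_le' (𝕜 := ℝ)
        (fun w hw => hp.differentiableAt hj isOpen_ball hw) hpd hz' hz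
    have e2 : ‖ContinuousLinearMap.adjoint (L z - L z') (fstE d m (p z))‖ ≤
        K * ‖y - y'‖ * σ := by
      refine (ContinuousLinearMap.le_opNorm _ _).trans ?_
      have h1 : ‖ContinuousLinearMap.adjoint (L z - L z')‖ ≤ K * ‖y - y'‖ := by
        rw [LinearIsometryEquiv.norm_map, ← hzz]
        exact hL.norm_sub_le hj isOpen_ball (convex_ball _ _) hz hz'
      exact mul_le_mul h1 ((norm_fstE_apply_le _).trans (hps z hz)) (norm_nonneg _)
        ((norm_nonneg _).trans h1)
    have e3 : ‖ContinuousLinearMap.adjoint (L z') (fstE d m (p z - p z'))‖ ≤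
        lam * (M * ‖y - y'‖) := by
      refine (ContinuousLinearMap.le_opNorm _ _).trans ?_
      have h1 : ‖p z - p z'‖ ≤ M * ‖y - y'‖ := by
        rw [← hzz]
        exact hp.norm_sub_le hj isOpen_ball (convex_ball _ _) hz hz'
      exact mul_le_mul (by rw [LinearIsometryEquiv.norm_map]; exact hLs z' hz')
        ((norm_fstE_apply_le _).trans h1) (norm_nonneg _) hlam
    have e4 : (y - R (graphComponent (L z) (p z))) - (y' - R (graphComponent (L z') (p z'))) =
        -R (sndE d m (p z - p z' - fderiv ℝ p 0 (z - z')) +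
          (ContinuousLinearMap.adjoint (L z - L z') (fstE d m (p z)) +
            ContinuousLinearMap.adjoint (L z') (fstE d m (p z - p z')))) := by
      rw [map_sub (sndE d m) (p z - p z'), map_add R, map_sub R, hRid]
      simp only [graphComponent, map_sub, map_add, sub_apply]
      abel
    rw [e4, norm_neg]
    refine (ContinuousLinearMap.le_of_opNorm_le _ hRn _).trans ?_
    have e5 := (norm_add_le _ _).trans (add_le_add ((norm_sndE_apply_le _).trans e1)
      ((norm_add_le _ _).trans (add_le_add e2 e3)))
    calc _ ≤ c₁⁻¹ * (τ * ‖y - y'‖ + (K * ‖y - y'‖ * σ + lam * (M * ‖y - y'‖))) :=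
          mul_le_mul_of_nonneg_left e5 hc
      _ = c₁⁻¹ * (τ + (K * σ + lam * M)) * ‖y - y'‖ := by ring
      _ ≤ _ := mul_le_mul_of_nonneg_right hsmall (norm_nonneg _)
  have h0 : ∀ x ∈ ball (0 : E (Fin d)) a, ‖G (x, 0)‖ ≤ c₁⁻¹ * ((1 + lam) * ‖p (pt x 0)‖) := by
    intro x hx
    rw [hGeq]
    refine (ContinuousLinearMap.le_of_opNorm_le _ hRn _).trans (mul_le_mul_of_nonneg_left ?_ hc)
    exact norm_graphComponent_le (hLs _ (pt_mem_ball hr0.le hab hx (mem_ball_self hb))) _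
  obtain ⟨Ψ, hΨ, huniq, hΨb⟩ := hK' hU hb hbr hU1 hG hlip (fun x hx =>
    (h0 x hx).trans_lt (lt_of_le_of_lt (by gcongr; exact hp0 x hx) hsmall0))
  refine ⟨Ψ, hΨb, fun x hx => ⟨(hΨ x hx).1, hRinj _ ?_, (hΨ x hx).2.2.trans ?_⟩,
    fun x hx y hy hxy => huniq x hx y hy ?_⟩
  · rw [← hGeq]; exact (hΨ x hx).2.1
  · exact mul_le_mul_of_nonneg_left (h0 x hx) zero_le_two
  · rw [hGeq, hxy, map_zero]

/-- Near the origin, every point lies on exactly one of the affine subspaces through the points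
`(x, Ψ x)` in the direction of the graph of `Λ x`. -/
theorem exists_foot_point {j : ℕ} (hj : 1 ≤ j) (K : ℝ) :
    ∃ K', ∀ {d m : ℕ} {r a lam σ : ℝ} {Λ : E (Fin d) → E (Fin m) →L[ℝ] E (Fin d)}
      {Ψ : E (Fin d) → E (Fin m)},
      r ≤ 1 → 0 < r → 0 < a → a ≤ 1 → BddCk j K Λ (ball 0 a) → BddCk j K Ψ (ball 0 a) →
      (∀ x ∈ ball 0 a, ‖Λ x‖ ≤ lam) →
      (∀ z ∈ ball (0 : E (Fin d ⊕ Fin m)) r, ∀ x ∈ ball 0 a, ‖sndE d m z - Ψ x‖ ≤ σ) →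
      K * σ + lam * K ≤ 1 / 2 → lam * σ + r < a / 2 →
      ∃ Φ : E (Fin d ⊕ Fin m) → E (Fin d), BddCk j K' Φ (ball 0 r) ∧
        (∀ z ∈ ball 0 r, Φ z ∈ ball 0 a ∧
          fstE d m z - Φ z = Λ (Φ z) (sndE d m z - Ψ (Φ z))) ∧
        ∀ z ∈ ball 0 r, ∀ x ∈ ball 0 a,
          fstE d m z - x = Λ x (sndE d m z - Ψ x) → x = Φ z := by
  obtain ⟨K', hK'⟩ := BddCk.exists_implicit hj
    ((1 + 2 ^ j * ((j.factorial * K * 1 ^ j) * (1 + j.factorial * K * 1 ^ j))) + 1)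
  refine ⟨K', fun {d m r a lam σ Λ Ψ} hr1 hr0 ha ha1 hΛ hΨ hΛs hσ hsmall hsmall0 => ?_⟩
  have hzero : (0 : E (Fin d)) ∈ ball (0 : E (Fin d)) a := mem_ball_self ha
  have hlam : 0 ≤ lam := (norm_nonneg _).trans (hΛs 0 hzero)
  let G : E (Fin d ⊕ Fin m) × E (Fin d) → E (Fin d) := fun q =>
    q.2 + Λ q.2 (sndE d m q.1 - Ψ q.2) - fstE d m q.1
  have hU : IsOpen (ball (0 : E (Fin d ⊕ Fin m)) r) := isOpen_ball
  have hV : IsOpen (ball (0 : E (Fin d ⊕ Fin m)) r ×ˢ ball (0 : E (Fin d)) a) :=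
    hU.prod isOpen_ball
  have hU1 : ∀ x ∈ ball (0 : E (Fin d ⊕ Fin m)) r, ‖x‖ ≤ 1 := fun x hx =>
    (mem_ball_zero_iff.1 hx).le.trans hr1
  have hV1 : ∀ q ∈ ball (0 : E (Fin d ⊕ Fin m)) r ×ˢ ball (0 : E (Fin d)) a, ‖q‖ ≤ 1 :=
    fun q hq => max_le (hU1 _ hq.1) ((mem_ball_zero_iff.1 hq.2).le.trans ha1)
  have hfst := BddCk.fst (j := j) hV le_rfl hV1
  have hsnd := BddCk.snd (j := j) hV le_rfl hV1
  have hΛ' := hΛ.comp hsnd hV isOpen_ball (fun q hq => hq.2) le_rfl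
  have hΨ' := hΨ.comp hsnd hV isOpen_ball (fun q hq => hq.2) le_rfl
  have hG : BddCk j ((1 + 2 ^ j * ((j.factorial * K * 1 ^ j) *
      (1 + j.factorial * K * 1 ^ j))) + 1) G (ball 0 r ×ˢ ball 0 a) :=
    (hsnd.add (hΛ'.clm_apply ((hfst.clm_comp_one hV (sndE d m) norm_sndE_le).sub hΨ' hV) hV)
      hV).sub (hfst.clm_comp_one hV (fstE d m) norm_fstE_le) hV
  have hlip : ∀ z ∈ ball (0 : E (Fin d ⊕ Fin m)) r, ∀ x ∈ ball (0 : E (Fin d)) a,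
      ∀ x' ∈ ball (0 : E (Fin d)) a,
      ‖(x - G (z, x)) - (x' - G (z, x'))‖ ≤ 1 / 2 * ‖x - x'‖ := by
    intro z hz x hx x' hx'
    have e1 : (x - G (z, x)) - (x' - G (z, x')) =
        -((Λ x - Λ x') (sndE d m z - Ψ x)) + Λ x' (Ψ x - Ψ x') := by
      simp only [G, sub_apply, map_sub]
      abel
    have e2 : ‖(Λ x - Λ x') (sndE d m z - Ψ x)‖ ≤ K * ‖x - x'‖ * σ := by
      have h1 := hΛ.norm_sub_le hj isOpen_ball (convex_ball _ _) hx hx'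
      exact (ContinuousLinearMap.le_opNorm _ _).trans
        (mul_le_mul h1 (hσ z hz x hx) (norm_nonneg _) ((norm_nonneg _).trans h1))
    have e3 : ‖Λ x' (Ψ x - Ψ x')‖ ≤ lam * (K * ‖x - x'‖) :=
      (ContinuousLinearMap.le_opNorm _ _).trans (mul_le_mul (hΛs x' hx')
        (hΨ.norm_sub_le hj isOpen_ball (convex_ball _ _) hx hx') (norm_nonneg _) hlam)
    rw [e1]
    refine (norm_add_le _ _).trans ?_
    rw [norm_neg]
    calc _ ≤ K * ‖x - x'‖ * σ + lam * (K * ‖x - x'‖) := add_le_add e2 e3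
      _ = (K * σ + lam * K) * ‖x - x'‖ := by ring
      _ ≤ _ := mul_le_mul_of_nonneg_right hsmall (norm_nonneg _)
  have hGiff : ∀ z x, G (z, x) = 0 ↔ fstE d m z - x = Λ x (sndE d m z - Ψ x) := fun z x => by
    simp only [G]
    rw [sub_eq_zero, sub_eq_iff_eq_add', eq_comm]
  obtain ⟨Φ, hΦ, huniq, hΦb⟩ := hK' hU ha ha1 hU1 hG hlip (fun z hz => by
    have h1 : ‖Λ 0 (sndE d m z - Ψ 0)‖ ≤ lam * σ := (ContinuousLinearMap.le_opNorm _ _).trans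
      (mul_le_mul (hΛs 0 hzero) (hσ z hz 0 hzero) (norm_nonneg _) hlam)
    have h2 : ‖fstE d m z‖ ≤ r := (norm_fstE_apply_le z).trans (mem_ball_zero_iff.1 hz).le
    have h3 : G (z, 0) = Λ 0 (sndE d m z - Ψ 0) - fstE d m z := by simp only [G, zero_add]
    rw [h3]
    exact ((norm_sub_le _ _).trans (add_le_add h1 h2)).trans_lt hsmall0)
  exact ⟨Φ, hΦb, fun z hz => ⟨(hΦ z hz).1, (hGiff _ _).1 (hΦ z hz).2.1⟩,
    fun z hz x hx h => huniq z hz x hx ((hGiff _ _).2 h)⟩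

/-- The coordinates `(Φd, Φv)` of a point along the graph of `Ψ`: the foot point and the component
in the direction of the graph of `L`. -/
theorem exists_coordinates {j : ℕ} (hj : 1 ≤ j) (K : ℝ) :
    ∃ K₃ K', ∀ {d m : ℕ} {r a lam σ : ℝ} {U : Set (E (Fin d ⊕ Fin m))}
      {L : E (Fin d ⊕ Fin m) → E (Fin m) →L[ℝ] E (Fin d)} {Ψ : E (Fin d) → E (Fin m)},
      r ≤ 1 → 0 < r → 0 < a → a ≤ 1 → IsOpen U → BddCk j K L U → BddCk j K Ψ (ball 0 a) →
      (∀ x ∈ ball 0 a, pt x (Ψ x) ∈ U) → (∀ x ∈ ball 0 a, ‖Ψ x‖ ≤ 1) →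
      (∀ z ∈ U, ‖L z‖ ≤ lam) →
      (∀ z ∈ ball (0 : E (Fin d ⊕ Fin m)) r, ∀ x ∈ ball 0 a, ‖sndE d m z - Ψ x‖ ≤ σ) →
      K₃ * σ + lam * K₃ ≤ 1 / 2 → lam * σ + r < a / 2 →
      ∃ (Φd : E (Fin d ⊕ Fin m) → E (Fin d)) (Φv : E (Fin d ⊕ Fin m) → E (Fin d ⊕ Fin m)),
        BddCk j K' Φd (ball 0 r) ∧ BddCk j K' Φv (ball 0 r) ∧
        (∀ z ∈ ball 0 r, Φd z ∈ ball 0 a ∧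
          Φv z ∈ (graphMap (L (pt (Φd z) (Ψ (Φd z))))).range ∧ Φv z ∈ ball 0 3 ∧
          z = pt (Φd z) (Ψ (Φd z)) + Φv z) ∧
        ∀ z ∈ ball 0 r, ∀ x ∈ ball 0 a, ∀ v ∈ (graphMap (L (pt x (Ψ x)))).range,
          z = pt x (Ψ x) + v → x = Φd z ∧ v = Φv z := by
  set K₁ : ℝ := 1 + max 1 K with hK₁
  set K₃ : ℝ := max (j.factorial * K * K₁ ^ j) K with hK₃
  obtain ⟨K₄, hK₄⟩ := exists_foot_point hj K₃
  refine ⟨K₃, max K₄ (1 + (K₄ + j.factorial * K * (max 1 K₄) ^ j)),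
    fun {d m r a lam σ U L Ψ} hr1 hr0 ha ha1 hU hL hΨ hmem hΨ1 hlam hσ hsmall hsmall0 => ?_⟩
  have hid : BddCk j 1 (fun x : E (Fin d) => inlE d m x) (ball 0 a) :=
    BddCk.clm (inlE d m) isOpen_ball norm_inlE_le le_rfl
      fun x hx => (mem_ball_zero_iff.1 hx).le.trans ha1
  have hpt : BddCk j K₁ (fun x : E (Fin d) => inlE d m x + inrE d m (Ψ x)) (ball 0 a) :=
    (hid.add (hΨ.clm_comp_one isOpen_ball (inrE d m) norm_inrE_le) isOpen_ball).mono
      (by rw [hK₁]; gcongr; exact le_max_right _ _)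
  have hΛ : BddCk j K₃ (fun x => L (pt x (Ψ x))) (ball 0 a) := by
    refine ((hL.comp hpt isOpen_ball hU (fun x hx => ?_) ?_).mono
      (le_max_left _ _)).congr isOpen_ball fun x _ => ?_
    · rw [← pt_eq]; exact hmem x hx
    · rw [hK₁]; linarith [le_max_left 1 K]
    · simp only [pt_eq]
  obtain ⟨Φ, hΦ, hΦz, huniq⟩ := hK₄ hr1 hr0 ha ha1 hΛ (hΨ.mono (le_max_right _ _))
    (fun x hx => hlam _ (hmem x hx)) hσ hsmall hsmall0
  have hΨΦ : BddCk j (j.factorial * K * (max 1 K₄) ^ j) (fun z => Ψ (Φ z)) (ball 0 r) :=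
    hΨ.comp (hΦ.mono (le_max_right _ _)) isOpen_ball isOpen_ball (fun z hz => (hΦz z hz).1)
      (le_max_left _ _)
  have hv : BddCk j (1 + (K₄ + j.factorial * K * (max 1 K₄) ^ j))
      (fun z => z - pt (Φ z) (Ψ (Φ z))) (ball 0 r) := by
    have h1 : BddCk j 1 (fun z : E (Fin d ⊕ Fin m) => z) (ball 0 r) :=
      BddCk.clm (ContinuousLinearMap.id ℝ _) isOpen_ball ContinuousLinearMap.norm_id_le le_rfl
        fun x hx => (mem_ball_zero_iff.1 hx).le.trans hr1
    refine (h1.sub ((hΦ.clm_comp_one isOpen_ball (inlE d m) norm_inlE_le).add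
      (hΨΦ.clm_comp_one isOpen_ball (inrE d m) norm_inrE_le) isOpen_ball) isOpen_ball).congr
      isOpen_ball fun z _ => ?_
    simp only [pt_eq]
  refine ⟨Φ, fun z => z - pt (Φ z) (Ψ (Φ z)), hΦ.mono (le_max_left _ _),
    hv.mono (le_max_right _ _), fun z hz => ⟨(hΦz z hz).1, ?_, ?_,
      (add_sub_cancel _ _).symm⟩,
    fun z hz x hx v hv hzv => ?_⟩
  · rw [mem_range_graphMap, map_sub, map_sub, fstE_pt, sndE_pt]
    exact (hΦz z hz).2
  · have h1 := mem_ball_zero_iff.1 hz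
    have h2 := mem_ball_zero_iff.1 (hΦz z hz).1
    have h3 := hΨ1 _ (hΦz z hz).1
    have h4 : ‖pt (Φ z) (Ψ (Φ z))‖ ≤ ‖Φ z‖ + ‖Ψ (Φ z)‖ := by
      rw [pt_eq]
      refine (norm_add_le _ _).trans ?_
      rw [norm_inlE_apply, norm_inrE_apply]
    rw [mem_ball_zero_iff]
    linarith [norm_sub_le z (pt (Φ z) (Ψ (Φ z)))]
  · have hx' : x = Φ z := by
      refine huniq z hz x hx ?_
      rw [mem_range_graphMap] at hv
      rw [hzv, map_add, map_add, fstE_pt, sndE_pt, add_sub_cancel_left, add_sub_cancel_left, hv]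
    refine ⟨hx', ?_⟩
    rw [hx'] at hzv
    exact eq_sub_of_add_eq' hzv.symm

/-! ### The top eigenspaces of the Hessian -/

/-- Near the origin, the top eigenspace of the Hessian is the graph of a small linear map `L`. -/
theorem exists_slope_of_hessian {j : ℕ} (hj : 1 ≤ j) (M : ℝ) {c₁ : ℝ} (hc₁ : 0 < c₁) :
    ∃ K, ∀ {d m : ℕ} {F : E (Fin d ⊕ Fin m) → ℝ} {r τ : ℝ},
      BddCk (j + 2) M F (ball 0 1) → 0 < r → r ≤ 1 → M * r ≤ τ / 4 → τ ≤ c₁ / 8 →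
      ‖(fderiv ℝ (gradient F) 0).comp (inlE d m)‖ ≤ τ / 2 →
      (∀ y, c₁ * ‖y‖ ^ 2 ≤ inner ℝ (fderiv ℝ (gradient F) 0 (inrE d m y)) (inrE d m y)) →
      ∃ (L : E (Fin d ⊕ Fin m) → E (Fin m) →L[ℝ] E (Fin d)) (R : E (Fin m) →L[ℝ] E (Fin m)),
        BddCk j K L (ball 0 r) ∧ (∀ z ∈ ball 0 r, ‖L z‖ ≤ 2 * τ / c₁) ∧
        (∀ z ∈ ball 0 r, N F z = (graphMap (L z)).range) ∧
        R.comp (((sndE d m).comp (fderiv ℝ (gradient F) 0)).comp (inrE d m)) =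
          ContinuousLinearMap.id ℝ _ ∧ ‖R‖ ≤ c₁⁻¹ ∧
        ∀ z ∈ ball 0 r, ‖fderiv ℝ (gradient F) z - fderiv ℝ (gradient F) 0‖ ≤ τ / 4 := by
  obtain ⟨K, hK⟩ := exists_slope hj M hc₁
  refine ⟨K, fun {d m F r τ} hF hr0 hr1 hMr hτ hl hco => ?_⟩
  have hsub : ball (0 : E (Fin d ⊕ Fin m)) r ⊆ ball 0 1 := ball_subset_ball hr1
  have h0 : (0 : E (Fin d ⊕ Fin m)) ∈ ball (0 : E (Fin d ⊕ Fin m)) r := mem_ball_self hr0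
  have hM : 0 ≤ M := (norm_nonneg _).trans (hF.norm_le (hsub h0))
  have hF2 : ∀ z ∈ ball (0 : E (Fin d ⊕ Fin m)) r, ContDiffAt ℝ 2 F z := fun z hz =>
    (hF.1.contDiffAt (isOpen_ball.mem_nhds (hsub hz))).of_le (by norm_cast; omega)
  have hH : BddCk j M (fderiv ℝ (gradient F)) (ball 0 r) :=
    ((bddCk_gradient hF isOpen_ball).fderiv isOpen_ball).mono_set hsub
  have hsymm : ∀ z ∈ ball (0 : E (Fin d ⊕ Fin m)) r, ∀ u v,
      inner ℝ (fderiv ℝ (gradient F) z u) v = inner ℝ u (fderiv ℝ (gradient F) z v) :=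
    fun z hz => inner_fderiv_gradient_comm (hF2 z hz)
  have hhess : ∀ z ∈ ball (0 : E (Fin d ⊕ Fin m)) r, hessian F z =
      (fderiv ℝ (gradient F) z : E (Fin d ⊕ Fin m) →ₗ[ℝ] E (Fin d ⊕ Fin m)) :=
    fun z hz => hessian_eq (hF2 z hz)
  set H := fderiv ℝ (gradient F)
  have hdiff : ∀ z ∈ ball (0 : E (Fin d ⊕ Fin m)) r, ‖H z - H 0‖ ≤ τ / 4 := by
    intro z hz
    refine (hH.norm_sub_le hj isOpen_ball (convex_ball _ _) hz h0).trans (le_trans ?_ hMr)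
    rw [sub_zero]
    exact mul_le_mul_of_nonneg_left (mem_ball_zero_iff.1 hz).le hM
  have hHl : ∀ z ∈ ball (0 : E (Fin d ⊕ Fin m)) r, ‖(H z).comp (inlE d m)‖ ≤ τ := by
    intro z hz
    have e1 : (H z).comp (inlE d m) = (H z - H 0).comp (inlE d m) + (H 0).comp (inlE d m) := by
      rw [ContinuousLinearMap.sub_comp, sub_add_cancel]
    have e2 := (norm_add_le _ _).trans
      (add_le_add (norm_comp_le_mul (hdiff z hz) norm_inlE_le) hl)
    rw [e1]
    linarith [(norm_nonneg _).trans hl]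
  have hτ0 : 0 ≤ τ := (norm_nonneg _).trans (hHl 0 h0)
  obtain ⟨R, hDR, hRD, hRn⟩ := exists_inverse_of_coercive
    (((sndE d m).comp (H 0)).comp (inrE d m)) hc₁ fun y => by
      refine (hco y).trans_eq ?_
      rw [real_inner_comm, inner_inrE_left, real_inner_comm]
      rfl
  obtain ⟨L, hL, hLz⟩ := hK isOpen_ball
    (fun z hz => (mem_ball_zero_iff.1 hz).le.trans hr1) hH hsymm hDR hRD hRn hτ hHl
    (fun z hz => by
      have e1 : ((sndE d m).comp (H 0)).comp (inrE d m) - ((sndE d m).comp (H z)).comp (inrE d m) =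
          ((sndE d m).comp (H 0 - H z)).comp (inrE d m) := by
        rw [ContinuousLinearMap.comp_sub, ContinuousLinearMap.sub_comp]
      rw [e1]
      refine (norm_comp_le_mul (norm_comp_le_mul norm_sndE_le
        ((norm_sub_rev _ _).trans_le (hdiff z hz))) norm_inrE_le).trans ?_
      linarith)
  refine ⟨L, R, hL, fun z hz => (hLz z hz).1, fun z hz => ?_, hRD, hRn, hdiff⟩
  have hL1 : ‖L z‖ ≤ 1 := by
    refine (hLz z hz).1.trans ?_
    rw [div_le_one hc₁]
    linarith
  have hcoz : ∀ y, 3 / 4 * c₁ * ‖y‖ ^ 2 ≤ inner ℝ (H z (inrE d m y)) (inrE d m y) := by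
    intro y
    have e1 : |inner ℝ ((H z - H 0) (inrE d m y)) (inrE d m y)| ≤ τ / 4 * ‖y‖ ^ 2 := by
      refine (abs_real_inner_le_norm _ _).trans ?_
      have := ContinuousLinearMap.le_of_opNorm_le _ (hdiff z hz) (inrE d m y)
      rw [norm_inrE_apply] at this ⊢
      rw [sq, ← mul_assoc]
      exact mul_le_mul_of_nonneg_right this (norm_nonneg _)
    rw [sub_apply, inner_sub_left] at e1
    have e2 := (abs_le.1 e1).1
    have e3 : τ / 4 * ‖y‖ ^ 2 ≤ 1 / 4 * c₁ * ‖y‖ ^ 2 := by gcongr; linarith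
    linarith [hco y]
  rw [N, hhess z hz]
  exact topEigenspan_eq_range_graphMap (hsymm z hz) hc₁ (hHl z hz) hτ hcoz hL1 (hLz z hz).2

theorem projHi_eq_zero_iff {d m : ℕ} {F : E (Fin d ⊕ Fin m) → ℝ} {z v : E (Fin d ⊕ Fin m)}
    {L : E (Fin m) →L[ℝ] E (Fin d)} (h : N F z = (graphMap L).range) :
    projHi F z v = 0 ↔ graphComponent L v = 0 := by
  rw [projHi, Submodule.starProjection_apply_eq_zero_iff, h]
  exact mem_orthogonal_range_graphMap

/-! ### The choice of the radii -/

/-- The radii: `τ` bounds the off-diagonal part of the Hessian, `c₂` to `c₇` are the radii of the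
balls, and `c` bounds `ρ`. Each of them is small in terms of the preceding ones. -/
theorem exists_radii (M K₁ K₃ P : ℝ) {c₁ : ℝ} (hc₁ : 0 < c₁) :
    ∃ τ c₂ c₃ c₄ c₅ c₇ c : ℝ,
      (0 < τ ∧ τ ≤ c₁ / 8 ∧ c₁⁻¹ * (τ + (K₁ * τ + 2 * τ / c₁ * M)) ≤ 1 / 2 ∧
        2 * τ / c₁ * K₃ ≤ 1 / 4 ∧ 2 * τ / c₁ * (4 * c₁⁻¹ * M) ≤ 1 / 8) ∧
      (0 < c₂ ∧ c₂ ≤ 1 ∧ M * c₂ ≤ τ / 4) ∧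
      (0 < c₃ ∧ 0 < c₄ ∧ c₃ ^ 2 + c₄ ^ 2 ≤ c₂ ^ 2 ∧ M * c₄ ≤ c₁ * c₃ / 16) ∧
      (0 < c₅ ∧ c₅ ≤ c₄ ∧ K₃ * (4 * c₁⁻¹ * M * c₅) ≤ 1 / 16) ∧
      (0 < c₇ ∧ c₇ ≤ c₅ / 8 ∧ K₃ * c₇ ≤ 1 / 16) ∧
      (0 < c ∧ P * c ≤ τ / 2 ∧ P * c ≤ c₁ * c₃ / 16 ∧ 4 * c₁⁻¹ * (P * c) ≤ c₇) := by
  -- each inequality has the form `A * t ≤ B`, and is satisfied by all small `t`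
  have small : ∀ A B : ℝ, 0 < B → ∀ᶠ t in nhdsWithin (0 : ℝ) (Ioi 0), A * t ≤ B := by
    intro A B hB
    have h1 : Filter.Tendsto (fun t : ℝ => A * t) (nhdsWithin (0 : ℝ) (Ioi 0)) (nhds (A * 0)) :=
      ((continuous_const.mul continuous_id).tendsto 0).mono_left nhdsWithin_le_nhds
    rw [mul_zero] at h1
    exact (h1.eventually (gt_mem_nhds hB)).mono fun t ht => le_of_lt ht
  have pos : ∀ᶠ t in nhdsWithin (0 : ℝ) (Ioi 0), (0 : ℝ) < t := eventually_mem_nhdsWithin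
  obtain ⟨τ, hτ, t1, t2, t3, t4⟩ := (pos.and ((small 1 (c₁ / 8) (by positivity)).and
    ((small (c₁⁻¹ * (1 + (K₁ + 2 / c₁ * M))) (1 / 2) (by norm_num)).and
    ((small (2 / c₁ * K₃) (1 / 4) (by norm_num)).and
    (small (2 / c₁ * (4 * c₁⁻¹ * M)) (1 / 8) (by norm_num)))))).exists
  obtain ⟨c₂, hc₂, a1, a2⟩ := (pos.and ((small 1 1 one_pos).and
    (small M (τ / 4) (by positivity)))).exists
  obtain ⟨c₄, hc₄, b1, b2⟩ := (pos.and ((small 1 (c₂ / 2) (by positivity)).and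
    (small M (c₁ * (c₂ / 2) / 16) (by positivity)))).exists
  obtain ⟨c₅, hc₅, d1, d2⟩ := (pos.and ((small 1 c₄ hc₄).and
    (small (K₃ * (4 * c₁⁻¹ * M)) (1 / 16) (by norm_num)))).exists
  obtain ⟨c₇, hc₇, f1, f2⟩ := (pos.and ((small 1 (c₅ / 8) (by positivity)).and
    (small K₃ (1 / 16) (by norm_num)))).exists
  obtain ⟨c, hc, g1, g2, g3⟩ := (pos.and ((small P (τ / 2) (by positivity)).and
    ((small P (c₁ * (c₂ / 2) / 16) (by positivity)).and
    (small (4 * c₁⁻¹ * P) c₇ hc₇)))).exists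
  rw [one_mul] at t1 a1 b1 d1 f1
  refine ⟨τ, c₂, c₂ / 2, c₄, c₅, c₇, c, ⟨hτ, t1, ?_, ?_, ?_⟩, ⟨hc₂, a1, a2⟩,
    ⟨by positivity, hc₄, ?_, b2⟩, ⟨hc₅, d1, ?_⟩, ⟨hc₇, f1, f2⟩, ⟨hc, g1, g2, ?_⟩⟩
  · exact (by ring : _ = _).trans_le t2
  · exact (by ring : _ = _).trans_le t3
  · exact (by ring : _ = _).trans_le t4
  · nlinarith
  · exact (by ring : _ = _).trans_le d2
  · exact (by ring : _ = _).trans_le g3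

end KeyLemma

end

set_option maxHeartbeats 1000000 in
open Set Metric KeyLemma in
theorem mainTheorem6 (n k : ℕ) (hk : 3 ≤ k) (C₀ c₁ C₁ : ℝ) (hc₁ : 0 < c₁) :
    ∃ c c₂ c₃ c₄ c₅ c₆ c₇ C : ℝ,
      0 < c ∧ 0 < c₂ ∧ 0 < c₃ ∧ 0 < c₄ ∧ 0 < c₅ ∧ 0 < c₆ ∧ 0 < c₇ ∧ 0 < C ∧
      c₂ ≤ 1 ∧ c₃ ^ 2 + c₄ ^ 2 ≤ c₂ ^ 2 ∧ c₅ ≤ c₄ ∧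
      ∀ (d m : ℕ), d + m = n →
      ∀ (ρ : ℝ) (F : KeyLemma.E (Fin d ⊕ Fin m) → ℝ),
        0 < ρ → ρ < c →
        ContDiffOn ℝ k F (Metric.ball 0 1) →
        KeyLemma.PartialsBoundedBy k C₀ F (Metric.ball 0 1) →
        (∀ (x : KeyLemma.E (Fin d)) (y : KeyLemma.E (Fin m)),
          KeyLemma.pt x y ∈ Metric.ball 0 1 →
            c₁ * (‖y‖ ^ 2 + ρ ^ 2) ≤ F (KeyLemma.pt x y) + ρ ^ 2 ∧
            F (KeyLemma.pt x y) + ρ ^ 2 ≤ C₁ * (‖y‖ ^ 2 + ρ ^ 2)) →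
        -- the projection onto the top eigenspace
        ((∀ z ∈ Metric.ball (0 : KeyLemma.E (Fin d ⊕ Fin m)) c₂,
            Module.finrank ℝ (KeyLemma.N F z) = m) ∧
          ContDiffOn ℝ (k - 2 : ℕ) (KeyLemma.projHi F) (Metric.ball 0 c₂) ∧
          KeyLemma.PartialsBoundedBy (k - 2) C (KeyLemma.projHi F) (Metric.ball 0 c₂)) ∧
        ∃ Ψ : KeyLemma.E (Fin d) → KeyLemma.E (Fin m),
          -- the graph
          (ContDiffOn ℝ (k - 2 : ℕ) Ψ (Metric.ball 0 c₄) ∧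
            Set.MapsTo Ψ (Metric.ball 0 c₄) (Metric.ball 0 c₃) ∧
            ‖Ψ 0‖ ≤ C * ρ ∧
            (∀ x ∈ Metric.ball (0 : KeyLemma.E (Fin d)) c₄,
              ∀ j : ℕ, 1 ≤ j → j ≤ k - 2 → ∀ σ : Fin j → Fin d,
                ‖KeyLemma.mixedPartial Ψ σ x‖ ≤ C ^ j) ∧
            {z | (∃ x ∈ Metric.ball (0 : KeyLemma.E (Fin d)) c₄,
                  ∃ y ∈ Metric.ball (0 : KeyLemma.E (Fin m)) c₃, z = KeyLemma.pt x y) ∧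
                KeyLemma.projHi F z (gradient F z) = 0} =
              {z | ∃ x ∈ Metric.ball (0 : KeyLemma.E (Fin d)) c₄, z = KeyLemma.pt x (Ψ x)}) ∧
          -- the decomposition of the points near the origin
          (∀ z ∈ Metric.ball (0 : KeyLemma.E (Fin d ⊕ Fin m)) c₇,
            ∃! p : KeyLemma.E (Fin d) × KeyLemma.E (Fin d ⊕ Fin m),
              p.1 ∈ Metric.ball 0 c₅ ∧
              p.2 ∈ KeyLemma.N F (KeyLemma.pt p.1 (Ψ p.1)) ∧
              p.2 ∈ Metric.ball 0 c₆ ∧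
              z = KeyLemma.pt p.1 (Ψ p.1) + p.2) ∧
          ∃ (Φd : KeyLemma.E (Fin d ⊕ Fin m) → KeyLemma.E (Fin d))
            (Φv : KeyLemma.E (Fin d ⊕ Fin m) → KeyLemma.E (Fin d ⊕ Fin m)),
            (∀ z ∈ Metric.ball (0 : KeyLemma.E (Fin d ⊕ Fin m)) c₇,
              Φd z ∈ Metric.ball 0 c₅ ∧
              Φv z ∈ KeyLemma.N F (KeyLemma.pt (Φd z) (Ψ (Φd z))) ∧
              Φv z ∈ Metric.ball 0 c₆ ∧
              z = KeyLemma.pt (Φd z) (Ψ (Φd z)) + Φv z) ∧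
            ContDiffOn ℝ (k - 2 : ℕ) Φd (Metric.ball 0 c₇) ∧
            ContDiffOn ℝ (k - 2 : ℕ) Φv (Metric.ball 0 c₇) ∧
            KeyLemma.PartialsBoundedBy (k - 2) C Φd (Metric.ball 0 c₇) ∧
            KeyLemma.PartialsBoundedBy (k - 2) C Φv (Metric.ball 0 c₇) := by
  obtain ⟨j, rfl⟩ : ∃ j, k = j + 2 := ⟨k - 2, by omega⟩
  have hj : 1 ≤ j := by omega
  rw [Nat.add_sub_cancel]
  set M : ℝ := 1 + (1 + n : ℝ) ^ (j + 2) * |C₀| with hM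
  have hM0 : 0 ≤ M := by positivity
  set P : ℝ := max C₁ 0 + 2 * M with hP
  have hP0 : 0 ≤ P := by positivity
  obtain ⟨K₁, hK₁⟩ := exists_slope_of_hessian hj M hc₁
  obtain ⟨Kp, hKp⟩ := exists_bddCk_projection hj K₁
  obtain ⟨K₂, hK₂⟩ := exists_critical_graph hj M K₁ c₁
  obtain ⟨K₃, K₄, hK₄⟩ := exists_coordinates hj (max K₁ K₂)
  obtain ⟨τ, c₂, c₃, c₄, c₅, c₇, c', ⟨hτ, t1, t2, t3, t4⟩, ⟨hc₂, a1, a2⟩, ⟨hc₃, hc₄, b1, b2⟩,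
    ⟨hc₅, d1, d2⟩, ⟨hc₇, f1, f2⟩, ⟨hc', g1, g2, g3⟩⟩ := exists_radii M K₁ K₃ P hc₁
  obtain ⟨cε, hcε, hest⟩ := exists_estimates_at_zero M c₁ C₁ hM0 hc₁ (half_pos hτ)
  set C : ℝ := 1 + |Kp| + |K₂| + |K₄| + 4 * c₁⁻¹ * P with hC
  have hC0 : 0 ≤ 4 * c₁⁻¹ * P := by positivity
  have hCs : 1 ≤ C ∧ Kp ≤ C ∧ K₂ ≤ C ∧ K₄ ≤ C ∧ 4 * c₁⁻¹ * P ≤ C := by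
    have h1 := abs_nonneg Kp
    have h2 := abs_nonneg K₂
    have h3 := abs_nonneg K₄
    have h4 := le_abs_self Kp
    have h5 := le_abs_self K₂
    have h6 := le_abs_self K₄
    refine ⟨?_, ?_, ?_, ?_, ?_⟩ <;> linarith
  obtain ⟨hC1, hCp, hC2, hC4, hCP⟩ := hCs
  -- `c₆ = 3` is no restriction: it exceeds `‖z‖ + ‖x‖ + ‖Ψ x‖`
  refine ⟨min cε c', c₂, c₃, c₄, c₅, 3, c₇, C, lt_min hcε hc', hc₂, hc₃, hc₄, hc₅, by norm_num,
    hc₇, one_pos.trans_le hC1, a1, b1, d1, ?_⟩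
  intro d m hdm ρ F hρ hρc hF hpart hineq
  have hFb : BddCk (j + 2) M F (ball 0 1) := by
    refine (hpart.bddCk hF).mono ?_
    have : Fintype.card (Fin d ⊕ Fin m) = n := by simp [hdm]
    rw [this, hM]
    linarith
  obtain ⟨e1, e2, e3⟩ := hest hρ (hρc.trans_le (min_le_left _ _)) (hFb.mono_order (by omega)) hineq
  have hρP : P * ρ ≤ P * c' :=
    mul_le_mul_of_nonneg_left (hρc.trans_le (min_le_right _ _)).le hP0
  have hp : BddCk (j + 1) M (gradient F) (ball 0 1) := bddCk_gradient hFb isOpen_ball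
  have hsub : ball (0 : E (Fin d ⊕ Fin m)) c₂ ⊆ ball 0 1 := ball_subset_ball a1
  have hpz : ∀ z ∈ ball (0 : E (Fin d ⊕ Fin m)) 1, ‖gradient F z‖ ≤ P * ρ + M * ‖z‖ := by
    intro z hz
    have h1 := hp.norm_sub_le (by omega) isOpen_ball (convex_ball _ _) hz (mem_ball_self one_pos)
    have h2 : (C₁ + 2 * M) * ρ ≤ P * ρ :=
      mul_le_mul_of_nonneg_right (by rw [hP]; linarith [le_max_left C₁ 0]) hρ.le
    rw [sub_zero] at h1
    have h3 := norm_add_le (gradient F z - gradient F 0) (gradient F 0)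
    rw [sub_add_cancel] at h3
    linarith
  obtain ⟨L, R, hL, hLn, hN, hR, hRn, hH⟩ := hK₁ hFb hc₂ a1 a2 t1 e2 e3
  have hlam : 2 * τ / c₁ ≤ 1 / 4 := by
    rw [div_le_iff₀ hc₁]
    linarith
  have hz1 : ∀ z ∈ ball (0 : E (Fin d ⊕ Fin m)) c₂, ‖z‖ ≤ 1 := fun z hz =>
    (mem_ball_zero_iff.1 hz).le.trans a1
  have hpτ : ∀ z ∈ ball (0 : E (Fin d ⊕ Fin m)) c₂, ‖gradient F z‖ ≤ τ := by
    intro z hz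
    have h1 := hpz z (hsub hz)
    have h2 : M * ‖z‖ ≤ M * c₂ := mul_le_mul_of_nonneg_left (mem_ball_zero_iff.1 hz).le hM0
    linarith
  -- on this ball `N F z` is the graph of `L z`
  have hproj : BddCk j Kp (projHi F) (ball 0 c₂) :=
    (hKp isOpen_ball hz1 hL fun z hz => (hLn z hz).trans (by linarith)).congr isOpen_ball
      fun z hz => by simp only [projHi, hN z hz]
  refine ⟨⟨fun z hz => ?_, hproj.1, (hproj.mono hCp).partialsBoundedBy⟩, ?_⟩
  · rw [hN z hz]; exact finrank_range_graphMap _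
  -- `(x, 0)` is nearly a solution of the equation for `Ψ x`, with error `O(ρ + |x|)`
  have hpt0 : ∀ x : E (Fin d), ‖pt x (0 : E (Fin m))‖ = ‖x‖ := fun x => by
    rw [pt_eq, map_zero, add_zero, norm_inlE_apply]
  have hc₄1 : c₄ ≤ 1 := by nlinarith
  have hpx : ∀ x ∈ ball (0 : E (Fin d)) c₄,
      ‖gradient F (pt x (0 : E (Fin m)))‖ ≤ P * ρ + M * ‖x‖ := by
    intro x hx
    have := hpz (pt x 0) (by
      rw [mem_ball_zero_iff, hpt0]; exact (mem_ball_zero_iff.1 hx).trans_le hc₄1)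
    rwa [hpt0] at this
  have hcinv : 0 < c₁⁻¹ := inv_pos.2 hc₁
  have hlam0 : 0 ≤ 2 * τ / c₁ := by positivity
  obtain ⟨Ψ, hΨ, hΨx, hΨu⟩ := hK₂ (lam := 2 * τ / c₁) (σ := τ) (σ₀ := c₁ * c₃ / 8) (τ := τ) a1 hc₂
    hc₄ hc₃ b1 ((hp.mono_order (Nat.le_succ j)).mono_set hsub) hL hLn hR hRn
    (fun z hz => (hH z hz).trans (by linarith)) hpτ t2
    (fun x hx => (hpx x hx).trans (by
      have : M * ‖x‖ ≤ M * c₄ := mul_le_mul_of_nonneg_left (mem_ball_zero_iff.1 hx).le hM0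
      linarith))
    (by
      have h1 : c₁⁻¹ * ((1 + 2 * τ / c₁) * (c₁ * c₃ / 8)) = (1 + 2 * τ / c₁) * c₃ / 8 := by
        field_simp
      rw [h1]
      nlinarith)
  have hΨn : ∀ x ∈ ball (0 : E (Fin d)) c₄, ‖Ψ x‖ ≤ 4 * c₁⁻¹ * (P * ρ + M * ‖x‖) := by
    intro x hx
    refine (hΨx x hx).2.2.trans ?_
    have h1 : (1 + 2 * τ / c₁) * ‖gradient F (pt x (0 : E (Fin m)))‖ ≤
        2 * (P * ρ + M * ‖x‖) :=
      mul_le_mul (by linarith) (hpx x hx) (norm_nonneg _) zero_le_two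
    have h2 := mul_le_mul_of_nonneg_left h1 hcinv.le
    linarith
  have hmem : ∀ x ∈ ball (0 : E (Fin d)) c₄, ∀ y ∈ ball (0 : E (Fin m)) c₃,
      pt x y ∈ ball (0 : E (Fin d ⊕ Fin m)) c₂ := fun x hx y hy => pt_mem_ball hc₂.le b1 hx hy
  refine ⟨Ψ, ⟨hΨ.1, fun x hx => (hΨx x hx).1, ?_, ?_, ?_⟩, ?_⟩
  · have := hΨn 0 (mem_ball_self hc₄)
    rw [norm_zero, mul_zero, add_zero, ← mul_assoc] at this
    exact this.trans (mul_le_mul_of_nonneg_right hCP hρ.le)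
  · intro x hx i hi1 hi σ
    exact ((norm_mixedPartial_le Ψ σ x).trans (hΨ.2 i hi x hx)).trans
      (hC2.trans (le_self_pow₀ hC1 (by omega)))
  · ext z
    constructor
    · rintro ⟨⟨x, hx, y, hy, rfl⟩, hz⟩
      rw [projHi_eq_zero_iff (hN _ (hmem x hx y hy))] at hz
      exact ⟨x, hx, by rw [← hΨu x hx y hy hz]⟩
    · rintro ⟨x, hx, rfl⟩
      have hy := (hΨx x hx).1
      exact ⟨⟨x, hx, Ψ x, hy, rfl⟩,
        (projHi_eq_zero_iff (hN _ (hmem x hx _ hy))).2 (hΨx x hx).2.1⟩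
  -- `Ψ` is small near the origin, and `L` is small, so that the foot point is close to `z_x`
  have hsub5 : ball (0 : E (Fin d)) c₅ ⊆ ball 0 c₄ := ball_subset_ball d1
  have hc₅1 : c₅ ≤ 1 := d1.trans hc₄1
  have hN5 : ∀ x ∈ ball (0 : E (Fin d)) c₅,
      N F (pt x (Ψ x)) = (graphMap (L (pt x (Ψ x)))).range := fun x hx =>
    hN _ (hmem x (hsub5 hx) _ (hΨx x (hsub5 hx)).1)
  obtain ⟨Φd, Φv, hΦd, hΦv, hΦ, huniq⟩ := hK₄ (r := c₇) (a := c₅) (lam := 2 * τ / c₁)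
    (σ := 2 * c₇ + 4 * c₁⁻¹ * M * c₅) (by linarith) hc₇ hc₅ hc₅1 isOpen_ball
    (hL.mono (le_max_left _ _)) ((hΨ.mono_set hsub5).mono (le_max_right _ _))
    (fun x hx => hmem x (hsub5 hx) _ (hΨx x (hsub5 hx)).1)
    (fun x hx => (mem_ball_zero_iff.1 (hΨx x (hsub5 hx)).1).le.trans (by nlinarith)) hLn
    (fun z hz x hx => by
      have h1 := (norm_sndE_apply_le z).trans (mem_ball_zero_iff.1 hz).le
      have h2 := hΨn x (hsub5 hx)
      have h3 : 4 * c₁⁻¹ * (P * ρ + M * ‖x‖) ≤ 4 * c₁⁻¹ * (P * c' + M * c₅) := by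
        gcongr
        exact (mem_ball_zero_iff.1 hx).le
      have h4 := norm_sub_le (sndE d m z) (Ψ x)
      linarith)
    (by linarith)
    (by
      have h1 : 2 * τ / c₁ * c₇ ≤ 1 / 4 * c₇ := mul_le_mul_of_nonneg_right hlam hc₇.le
      have h2 := mul_le_mul_of_nonneg_right t4 hc₅.le
      linarith)
  refine ⟨fun z hz => ⟨(Φd z, Φv z), ?_, ?_⟩, Φd, Φv, fun z hz => ?_, hΦd.1, hΦv.1,
    (hΦd.mono hC4).partialsBoundedBy, (hΦv.mono hC4).partialsBoundedBy⟩
  · obtain ⟨h1, h2, h3, h4⟩ := hΦ z hz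
    exact ⟨h1, by rw [hN5 _ h1]; exact h2, h3, h4⟩
  · rintro ⟨x, v⟩ ⟨h1, h2, -, h4⟩
    have h2' : v ∈ N F (pt x (Ψ x)) := h2
    rw [hN5 x h1] at h2'
    obtain ⟨hx, hv⟩ := huniq z hz x h1 v h2' h4
    rw [hx, hv]
  · obtain ⟨h1, h2, h3, h4⟩ := hΦ z hz
    exact ⟨h1, by rw [hN5 _ h1]; exact h2, h3, h4⟩
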